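/- **Setting.** Let $k$ be a field, $S=k[x_1,\dots,x_n]$ and $S'=k[y_1,\dots,y_{n'}]$ standard graded polynomial rings, and $I\subset S$, $I'\subset S'$ homogeneous ideals. A graded free resolution $\mathbf F$ of $S/I$ is an exact sequence $\cdots\to F_2\to F_1\to S\to S/I\to 0$ of graded $S$-modules, of finite or infinite length, with $F_i=\bigoplus_{j\ge 0}S(-j)^{\beta_{i,j}(\mathbf F)}$ of finite rank. Put $m_i(\mathbf F)=\min\{j:\beta_{i,j}(\mathbf F)\ne0\}$ and $M_i(\mathbf F)=\max\{j:\beta_{i,j}(\mathbf F)\ne0\}$. Let $c=\dim S-\dim S/I$ be the codimension of $I$, and let $e(S/I)$ be the multiplicity, i.e. $e(S/I)=Q(1)$ where $Q(t)/(1-t)^{\dim S/I}$ is the Hilbert series of $S/I$. We say that $S/I$ satisfies * the *lower bound* for $\mathbf F$ if $\frac1{c!}\prod_{i=1}^{c}m_i(\mathbf F)\le e(S/I)$; * the *upper bound* for $\mathbf F$ if $e(S/I)\le\frac1{c!}\prod_{i=1}^{c}M_i(\mathbf F)$; * the *$\mathbf F$-multiplicity conjecture* if it satisfies the upper bound for $\mathbf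 F$ and, in case $S/I$ is Cohen–Macaulay, also the lower bound for $\mathbf F$. For $\mathbf F$ the minimal graded free resolution this is the *multiplicity conjecture*; for $I$ a monomial ideal and $\mathbf F$ the Taylor resolution on the minimal monomial generators of $I$ it is the *Taylor conjecture*. The same terminology is used for $S'/I'$, and for $(S/I)\otimes_k(S'/I')$, regarded as the quotient of $S''=S\otimes_kS'=k[x_1,\dots,x_n,y_1,\dots,y_{n'}]$ by the homogeneous ideal $IS''+I'S''$. **Theorem.** Let $\mathbf F$ and $\mathbf F'$ be graded free resolutions of $S/I$ and $S'/I'$. Then $\mathbf F\otimes_k\mathbf F'$ is a graded free resolution of $(S/I)\otimes_k(S'/I')$, and: 1. if $S/I$ and $S'/I'$ satisfy the lower bounds for $\mathbf F$ and $\mathbf F'$, then $(S/I)\otimes_k(S'/I')$ satisfies the lower bound for $\mathbf F\otimes_k\mathbf F'$; 2. if $S/I$ and $S'/I'$ satisfy the upper bounds for $\mathbf F$ and $\mathbf F'$, then $(S/I)\otimes_k(S'/I')$ satisfies the upper bound for $\mathbf F\otimes_k\mathbf F'$; 3. if $S/I$ and $S'/I'$ satisfy the $\mathbf F$- and the $\mathbf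 F'$-multiplicity conjecture, then $(S/I)\otimes_k(S'/I')$ satisfies the $(\mathbf F\otimes_k\mathbf F')$-multiplicity conjecture. **Corollary.** If $S/I$ and $S'/I'$ satisfy the multiplicity conjecture (or just its lower bound, or just its upper bound), then so does $(S/I)\otimes_k(S'/I')$. If $I$ and $I'$ are monomial ideals, then $IS''+I'S''$ is a monomial ideal, and if $S/I$ and $S'/I'$ satisfy the Taylor conjecture (or just its lower bound, or just its upper bound), then so does $(S/I)\otimes_k(S'/I')$. -/

import Mathlib

open MvPolynomial
open scoped Nat TensorProduct

/-- A graded complex `⋯ → F₂ → F₁ → F₀` of finitely generated graded free modules over the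
polynomial ring `S = k[x_s : s ∈ σ]`, given in homogeneous bases.  All basis elements of all the
`F i` are collected in one type `basis`; `F i` is the free module on the basis elements `b` with
`hdeg b = i`, and `b` generates a summand `S(-deg b)`.  The differential sends the basis element
`b` to `d b`. -/
structure GradedFreeComplex (k : Type*) [Field k] (σ : Type*) where
  /-- the homogeneous basis elements of all the modules `F i` -/
  basis : Type
  /-- the homological degree of a basis element -/
  hdeg : basis → ℕ
  /-- the internal degree (shift) of a basis element -/
  deg : basis → ℕ
  /-- the image of a basis element under the differential -/
  d : basis → basis →₀ MvPolynomial σ k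
  finite_basis : ∀ i, {b | hdeg b = i}.Finite
  d_hdeg : ∀ b a, d b a ≠ 0 → hdeg b = hdeg a + 1
  d_deg : ∀ b a, d b a ≠ 0 → deg a ≤ deg b ∧ (d b a).IsHomogeneous (deg b - deg a)
  d_comp_d : ∀ b, Finsupp.linearCombination (MvPolynomial σ k) d (d b) = 0

namespace GradedFreeComplex

variable {k : Type*} [Field k] {σ τ : Type*}

/-- The differential, as an `S`-linear endomorphism of `⨁ i, F i`. -/
noncomputable def diff (F : GradedFreeComplex k σ) :
    (F.basis →₀ MvPolynomial σ k) →ₗ[MvPolynomial σ k] (F.basis →₀ MvPolynomial σ k) :=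
  Finsupp.linearCombination (MvPolynomial σ k) F.d

/-- The module `F i`, as a submodule of `⨁ i, F i`. -/
noncomputable def term (F : GradedFreeComplex k σ) (i : ℕ) :
    Submodule (MvPolynomial σ k) (F.basis →₀ MvPolynomial σ k) :=
  Finsupp.supported (MvPolynomial σ k) (MvPolynomial σ k) {b | F.hdeg b = i}

/-- `F` is a graded free resolution `⋯ → F₂ → F₁ → S → S/I → 0` of `S/I`: the module `F 0` is `S`
(one basis element, of degree `0`), the image of `F 1` in `S` is `I`, and `F` is exact at `F i` for
all `i ≥ 1`.  (That the image of the differential lies in its kernel is part of the structure.) -/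
def IsResolution (F : GradedFreeComplex k σ) (I : Ideal (MvPolynomial σ k)) : Prop :=
  (∃ b₀, {b | F.hdeg b = 0} = {b₀} ∧ F.deg b₀ = 0 ∧
    ∀ f : MvPolynomial σ k, f ∈ I ↔ ∃ x ∈ F.term 1, F.diff x = Finsupp.single b₀ f) ∧
  ∀ i, ∀ x ∈ F.term (i + 1), F.diff x = 0 → ∃ y ∈ F.term (i + 2), F.diff y = x

/-- A complex is minimal if `d(F) ⊆ (x_s : s ∈ σ) F`, that is, if the entries of the matrices of
the differential have no constant term. -/
def IsMinimal (F : GradedFreeComplex k σ) : Prop :=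
  ∀ b a, constantCoeff (F.d b a) = 0

/-- The graded Betti number `β i j` of the complex: `F i = ⨁ j, S(-j) ^ (β i j)`. -/
noncomputable def betti (F : GradedFreeComplex k σ) (i j : ℕ) : ℕ :=
  {b | F.hdeg b = i ∧ F.deg b = j}.ncard

/-- `j` is the minimal shift `m i` of `F` in homological degree `i`. -/
def IsMinShift (F : GradedFreeComplex k σ) (i j : ℕ) : Prop :=
  IsLeast {j | F.betti i j ≠ 0} j

/-- `j` is the maximal shift `M i` of `F` in homological degree `i`. -/
def IsMaxShift (F : GradedFreeComplex k σ) (i j : ℕ) : Prop :=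
  IsGreatest {j | F.betti i j ≠ 0} j

/-- The differential of the tensor product of two complexes:
`d (b ⊗ b') = d b ⊗ b' + (-1) ^ (hdeg b) b ⊗ d b'`. -/
noncomputable def tensorD (F : GradedFreeComplex k σ) (F' : GradedFreeComplex k τ)
    (p : F.basis × F'.basis) : F.basis × F'.basis →₀ MvPolynomial (σ ⊕ τ) k :=
  ((F.d p.1).sum fun a f => Finsupp.single (a, p.2) (rename Sum.inl f)) +
    (-1 : MvPolynomial (σ ⊕ τ) k) ^ F.hdeg p.1 •
      ((F'.d p.2).sum fun a' f => Finsupp.single (p.1, a') (rename Sum.inr f))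

lemma tensorD_ne_zero (F : GradedFreeComplex k σ) (F' : GradedFreeComplex k τ)
    (p q : F.basis × F'.basis) (h : F.tensorD F' p q ≠ 0) :
    (F.d p.1 q.1 ≠ 0 ∧ q.2 = p.2) ∨ (F'.d p.2 q.2 ≠ 0 ∧ q.1 = p.1) := by
  classical
  by_contra hcon
  push Not at hcon
  apply h
  rw [tensorD, Finsupp.add_apply, Finsupp.smul_apply, Finsupp.sum_apply, Finsupp.sum_apply,
    Finsupp.sum, Finsupp.sum, Finset.sum_eq_zero, Finset.sum_eq_zero]
  · simp
  · intro a ha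
    rw [Finsupp.single_apply, if_neg]
    rintro rfl
    exact hcon.2 (by simpa using ha) rfl
  · intro a ha
    rw [Finsupp.single_apply, if_neg]
    rintro rfl
    exact hcon.1 (by simpa using ha) rfl

lemma tensorD_apply_of_ne (F : GradedFreeComplex k σ) (F' : GradedFreeComplex k τ)
    (p q : F.basis × F'.basis) (h1 : q.2 = p.2) (h2 : q.1 ≠ p.1) :
    F.tensorD F' p q = rename Sum.inl (F.d p.1 q.1) := by
  classical
  obtain ⟨b, b'⟩ := p
  obtain ⟨a, a'⟩ := q
  dsimp only at h1 h2
  subst h1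
  rw [tensorD, Finsupp.add_apply, Finsupp.smul_apply, Finsupp.sum_apply, Finsupp.sum_apply,
    Finsupp.sum, Finsupp.sum]
  simp only [Finsupp.single_apply, Prod.mk.injEq, and_true, h2.symm, false_and, if_false,
    Finset.sum_const_zero, smul_zero, add_zero]
  rw [Finset.sum_ite_eq']
  split_ifs with h
  · rfl
  · simp only [Finsupp.mem_support_iff, not_not] at h
    simp [h]

lemma tensorD_apply_of_ne' (F : GradedFreeComplex k σ) (F' : GradedFreeComplex k τ)
    (p q : F.basis × F'.basis) (h1 : q.1 = p.1) (h2 : q.2 ≠ p.2) :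
    F.tensorD F' p q = (-1) ^ F.hdeg p.1 * rename Sum.inr (F'.d p.2 q.2) := by
  classical
  obtain ⟨b, b'⟩ := p
  obtain ⟨a, a'⟩ := q
  dsimp only at h1 h2
  subst h1
  rw [tensorD, Finsupp.add_apply, Finsupp.smul_apply, Finsupp.sum_apply, Finsupp.sum_apply,
    Finsupp.sum, Finsupp.sum]
  simp only [Finsupp.single_apply, Prod.mk.injEq, true_and, h2.symm, and_false, if_false,
    Finset.sum_const_zero, zero_add]
  rw [Finset.sum_ite_eq']
  split_ifs with h
  · rfl
  · simp only [Finsupp.mem_support_iff, not_not] at h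
    simp [h]

lemma tensorD_comp (F : GradedFreeComplex k σ) (F' : GradedFreeComplex k τ)
    (p : F.basis × F'.basis) :
    Finsupp.linearCombination (MvPolynomial (σ ⊕ τ) k) (F.tensorD F') (F.tensorD F' p) = 0 := by
  classical
  obtain ⟨b, b'⟩ := p
  -- the two partial differentials
  let L : F'.basis → (F.basis →₀ MvPolynomial σ k) → (F.basis × F'.basis →₀ MvPolynomial (σ ⊕ τ) k) :=
    fun b' x => x.sum fun a f => Finsupp.single (a, b') (rename Sum.inl f)
  let R : F.basis → (F'.basis →₀ MvPolynomial τ k) → (F.basis × F'.basis →₀ MvPolynomial (σ ⊕ τ) k) :=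
    fun b x => x.sum fun a' f => Finsupp.single (b, a') (rename Sum.inr f)
  have hLd : ∀ b' x, L b' (Finsupp.linearCombination (MvPolynomial σ k) F.d x) =
      x.sum fun a f => (rename Sum.inl f : MvPolynomial (σ ⊕ τ) k) • L b' (F.d a) := by
    intro b' x
    have key : ∀ (f : MvPolynomial σ k) (y : F.basis →₀ MvPolynomial σ k), L b' (f • y) = (rename Sum.inl f : MvPolynomial (σ ⊕ τ) k) • L b' y := by
      intro f y
      simp only [L]
      rw [Finsupp.sum_smul_index (by simp), Finsupp.smul_sum]
      simp
    have hadd : ∀ y z, L b' (y + z) = L b' y + L b' z := by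
      intro y z
      exact Finsupp.sum_add_index' (by simp) (by simp)
    have hzero : L b' 0 = 0 := Finsupp.sum_zero_index
    let Lh : (F.basis →₀ MvPolynomial σ k) →+ (F.basis × F'.basis →₀ MvPolynomial (σ ⊕ τ) k) :=
      { toFun := L b', map_zero' := hzero, map_add' := hadd }
    rw [Finsupp.linearCombination_apply]
    change Lh _ = _
    rw [map_finsuppSum]
    exact Finsupp.sum_congr fun a _ => key _ _
  have hRd : ∀ b x, R b (Finsupp.linearCombination (MvPolynomial τ k) F'.d x) =
      x.sum fun a f => (rename Sum.inr f : MvPolynomial (σ ⊕ τ) k) • R b (F'.d a) := by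
    intro b x
    have key : ∀ (f : MvPolynomial τ k) (y : F'.basis →₀ MvPolynomial τ k), R b (f • y) = (rename Sum.inr f : MvPolynomial (σ ⊕ τ) k) • R b y := by
      intro f y
      simp only [R]
      rw [Finsupp.sum_smul_index (by simp), Finsupp.smul_sum]
      simp
    have hadd : ∀ y z, R b (y + z) = R b y + R b z := by
      intro y z
      exact Finsupp.sum_add_index' (by simp) (by simp)
    have hzero : R b 0 = 0 := Finsupp.sum_zero_index
    let Rh : (F'.basis →₀ MvPolynomial τ k) →+ (F.basis × F'.basis →₀ MvPolynomial (σ ⊕ τ) k) :=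
      { toFun := R b, map_zero' := hzero, map_add' := hadd }
    rw [Finsupp.linearCombination_apply]
    change Rh _ = _
    rw [map_finsuppSum]
    exact Finsupp.sum_congr fun a _ => key _ _
  have hD : ∀ a a', F.tensorD F' (a, a') =
      L a' (F.d a) + (-1 : MvPolynomial (σ ⊕ τ) k) ^ F.hdeg a • R a (F'.d a') :=
    fun _ _ => rfl
  rw [hD b b', map_add, map_smul]
  have e1 : Finsupp.linearCombination (MvPolynomial (σ ⊕ τ) k) (F.tensorD F') (L b' (F.d b)) =
      (F.d b).sum fun a f => (rename Sum.inl f : MvPolynomial (σ ⊕ τ) k) • (L b' (F.d a) +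
        (-1 : MvPolynomial (σ ⊕ τ) k) ^ F.hdeg a • R a (F'.d b')) := by
    simp only [L]
    rw [map_finsuppSum]
    simp only [Finsupp.linearCombination_single, hD, L]
  have e2 : Finsupp.linearCombination (MvPolynomial (σ ⊕ τ) k) (F.tensorD F') (R b (F'.d b')) =
      (F'.d b').sum fun a' f => (rename Sum.inr f : MvPolynomial (σ ⊕ τ) k) • (L a' (F.d b) +
        (-1 : MvPolynomial (σ ⊕ τ) k) ^ F.hdeg b • R b (F'.d a')) := by
    simp only [R]
    rw [map_finsuppSum]
    simp only [Finsupp.linearCombination_single, hD, R]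
  rw [e1, e2]
  simp only [smul_add, Finsupp.sum_add]
  rw [← hLd, F.d_comp_d]
  have hL0 : L b' 0 = 0 := Finsupp.sum_zero_index
  have e3 : ((F'.d b').sum fun a' f => (rename Sum.inr f : MvPolynomial (σ ⊕ τ) k) •
      (-1 : MvPolynomial (σ ⊕ τ) k) ^ F.hdeg b • R b (F'.d a')) = 0 := by
    have : ∀ a' (f : MvPolynomial τ k), (rename Sum.inr f : MvPolynomial (σ ⊕ τ) k) •
      (-1 : MvPolynomial (σ ⊕ τ) k) ^ F.hdeg b • R b (F'.d a') =
      (-1 : MvPolynomial (σ ⊕ τ) k) ^ F.hdeg b • rename Sum.inr f • R b (F'.d a') :=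
      fun a' f => smul_comm _ _ _
    simp only [this]
    rw [← Finsupp.smul_sum, ← hRd, F'.d_comp_d]
    have hR0 : R b 0 = 0 := Finsupp.sum_zero_index
    rw [hR0, smul_zero]
  rw [e3, hL0, smul_zero, add_zero, zero_add]
  -- the two mixed terms cancel
  have e4 : ((F.d b).sum fun a f => (rename Sum.inl f : MvPolynomial (σ ⊕ τ) k) •
        (-1 : MvPolynomial (σ ⊕ τ) k) ^ F.hdeg a • R a (F'.d b')) =
      -((-1 : MvPolynomial (σ ⊕ τ) k) ^ F.hdeg b •
        ((F.d b).sum fun a f => (rename Sum.inl f : MvPolynomial (σ ⊕ τ) k) • R a (F'.d b'))) := by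
    rw [Finsupp.smul_sum, Finsupp.sum, Finsupp.sum, ← Finset.sum_neg_distrib]
    refine Finset.sum_congr rfl fun a ha => ?_
    rw [F.d_hdeg b a (by simpa using ha), pow_succ, smul_comm]
    simp
  rw [e4, neg_add_eq_zero]
  congr 1
  simp only [L, R, Finsupp.smul_sum, Finsupp.smul_single, smul_eq_mul]
  rw [Finsupp.sum_comm]
  simp only [mul_comm]

/-- The tensor product `F ⊗_k F'`, a complex over
`S ⊗_k S' = k[x_s, y_t : s ∈ σ, t ∈ τ]` with basis the elements `b ⊗ b'`. -/
noncomputable def tensor (F : GradedFreeComplex k σ) (F' : GradedFreeComplex k τ) :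
    GradedFreeComplex k (σ ⊕ τ) where
  basis := F.basis × F'.basis
  hdeg p := F.hdeg p.1 + F'.hdeg p.2
  deg p := F.deg p.1 + F'.deg p.2
  d := F.tensorD F'
  finite_basis i := by
    refine Set.Finite.subset (Set.Finite.prod
      (Set.Finite.biUnion (Set.finite_Iic i) fun j _ => F.finite_basis j)
      (Set.Finite.biUnion (Set.finite_Iic i) fun j _ => F'.finite_basis j)) ?_
    rintro ⟨a, b⟩ h
    simp only [Set.mem_ofPred_eq] at h
    simp only [Set.mem_prod, Set.mem_iUnion, Set.mem_Iic, Set.mem_ofPred_eq, exists_prop]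
    exact ⟨⟨_, by omega, rfl⟩, ⟨_, by omega, rfl⟩⟩
  d_hdeg p q h := by
    rcases F.tensorD_ne_zero F' p q h with ⟨h1, h2⟩ | ⟨h1, h2⟩
    · rw [F.d_hdeg _ _ h1, h2]; ring
    · rw [F'.d_hdeg _ _ h1, h2]; ring
  d_deg p q h := by
    rcases F.tensorD_ne_zero F' p q h with ⟨h1, h2⟩ | ⟨h1, h2⟩
    · have hne : q.1 ≠ p.1 := fun he => by
        have := F.d_hdeg _ _ h1; rw [he] at this; omega
      obtain ⟨h3, h4⟩ := F.d_deg _ _ h1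
      rw [F.tensorD_apply_of_ne F' p q h2 hne, h2]
      refine ⟨by omega, ?_⟩
      have : F.deg p.1 + F'.deg p.2 - (F.deg q.1 + F'.deg p.2) = F.deg p.1 - F.deg q.1 := by omega
      rw [this]
      exact h4.rename_isHomogeneous
    · have hne : q.2 ≠ p.2 := fun he => by
        have := F'.d_hdeg _ _ h1; rw [he] at this; omega
      obtain ⟨h3, h4⟩ := F'.d_deg _ _ h1
      rw [F.tensorD_apply_of_ne' F' p q h2 hne, h2]
      refine ⟨by omega, ?_⟩
      have : F.deg p.1 + F'.deg p.2 - (F.deg p.1 + F'.deg q.2) =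
        0 + (F'.deg p.2 - F'.deg q.2) := by omega
      rw [this]
      refine IsHomogeneous.mul ?_ h4.rename_isHomogeneous
      have := (isHomogeneous_C (σ ⊕ τ) ((-1 : k) ^ F.hdeg p.1))
      simpa using this
  d_comp_d := F.tensorD_comp F'

end GradedFreeComplex

attribute [local instance] MvPolynomial.gradedAlgebra

namespace MultiplicityConjecture

variable {k : Type*} [Field k] {σ τ : Type*}

/-- The ideal `I S'' + I' S''` of `S'' = k[x_s, y_t : s ∈ σ, t ∈ τ]`, which presents
`(S/I) ⊗_k (S'/I')` as a quotient of `S''`. -/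
noncomputable def tensorIdeal (I : Ideal (MvPolynomial σ k)) (I' : Ideal (MvPolynomial τ k)) :
    Ideal (MvPolynomial (σ ⊕ τ) k) :=
  I.map (rename Sum.inl) ⊔ I'.map (rename Sum.inr)

/-- The Hilbert series `∑ d, dim_k (S/I)_d t ^ d`. -/
noncomputable def hilbertSeries (I : Ideal (MvPolynomial σ k)) : PowerSeries ℤ :=
  PowerSeries.mk fun d =>
    (Module.finrank k
      ((homogeneousSubmodule σ k d).map (Ideal.Quotient.mkₐ k I).toLinearMap) : ℤ)

/-- `I` has codimension `c`, i.e. `c = dim S - dim S/I`. -/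
def HasCodim (I : Ideal (MvPolynomial σ k)) (c : ℕ) : Prop :=
  ringKrullDim (MvPolynomial σ k ⧸ I) + (c : WithBot ℕ∞) = (Nat.card σ : WithBot ℕ∞)

/-- `S/I` has multiplicity `e`: writing the Hilbert series as `Q(t) / (1 - t) ^ D` with a
polynomial `Q` and `D = dim S/I`, one has `e = Q(1)`. -/
def HasMultiplicity (I : Ideal (MvPolynomial σ k)) (e : ℕ) : Prop :=
  ∃ D : ℕ, ringKrullDim (MvPolynomial σ k ⧸ I) = (D : WithBot ℕ∞) ∧
    ∃ Q : Polynomial ℤ,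
      (Q : PowerSeries ℤ) = hilbertSeries I * (1 - PowerSeries.X) ^ D ∧ Q.eval 1 = (e : ℤ)

/-- The graded ring `S/I` (`I` a homogeneous ideal) is Cohen-Macaulay: its depth equals its Krull
dimension, i.e. the ideal of the variables contains an `S/I`-regular sequence of length
`dim S/I`. -/
def IsCohenMacaulay (I : Ideal (MvPolynomial σ k)) : Prop :=
  ∃ rs : List (MvPolynomial σ k), (∀ r ∈ rs, r ∈ idealOfVars σ k) ∧
    RingTheory.Sequence.IsRegular (MvPolynomial σ k ⧸ I) rs ∧
    ringKrullDim (MvPolynomial σ k ⧸ I) = (rs.length : WithBot ℕ∞)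

/-- The lower bound inequality of the `F`-multiplicity conjecture for `S/I`:
`(∏_{i=1}^c m_i(F)) / c! ≤ e(S/I)`, where `c = codim I`. -/
def SatisfiesLowerBound (F : GradedFreeComplex k σ) (I : Ideal (MvPolynomial σ k)) : Prop :=
  ∃ (c e : ℕ) (m : ℕ → ℕ), HasCodim I c ∧ HasMultiplicity I e ∧
    (∀ i ∈ Finset.Icc 1 c, F.IsMinShift i (m i)) ∧
    (∏ i ∈ Finset.Icc 1 c, (m i : ℚ)) / (c ! : ℚ) ≤ (e : ℚ)

/-- The upper bound inequality of the `F`-multiplicity conjecture for `S/I`: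
`e(S/I) ≤ (∏_{i=1}^c M_i(F)) / c!`, where `c = codim I`. -/
def SatisfiesUpperBound (F : GradedFreeComplex k σ) (I : Ideal (MvPolynomial σ k)) : Prop :=
  ∃ (c e : ℕ) (M : ℕ → ℕ), HasCodim I c ∧ HasMultiplicity I e ∧
    (∀ i ∈ Finset.Icc 1 c, F.IsMaxShift i (M i)) ∧
    (e : ℚ) ≤ (∏ i ∈ Finset.Icc 1 c, (M i : ℚ)) / (c ! : ℚ)

/-- The `F`-multiplicity conjecture for `S/I`: the upper bound holds, and, if `S/I` is
Cohen-Macaulay, so does the lower bound. -/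
def SatisfiesConjecture (F : GradedFreeComplex k σ) (I : Ideal (MvPolynomial σ k)) : Prop :=
  SatisfiesUpperBound F I ∧ (IsCohenMacaulay I → SatisfiesLowerBound F I)

/-- The minimal graded free resolution of `S/I` (which is unique up to isomorphism) has the
property `P`. -/
def MinimalResolutionSatisfies (P : GradedFreeComplex k σ → Ideal (MvPolynomial σ k) → Prop)
    (I : Ideal (MvPolynomial σ k)) : Prop :=
  ∃ F : GradedFreeComplex k σ, F.IsResolution I ∧ F.IsMinimal ∧ P F I

/-- `I` is generated by monomials. -/
def IsMonomialIdeal (I : Ideal (MvPolynomial σ k)) : Prop :=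
  ∃ A : Set (σ →₀ ℕ), I = Ideal.span ((fun s => monomial s (1 : k)) '' A)

/-- The exponents of the minimal monomial generators of a monomial ideal `I`. -/
def gens (I : Ideal (MvPolynomial σ k)) : Set (σ →₀ ℕ) :=
  {s | Minimal (fun s => monomial s (1 : k) ∈ I) s}

lemma gens_finite [Finite σ] (I : Ideal (MvPolynomial σ k)) : (gens I).Finite :=
  WellQuasiOrderedLE.finite_of_isAntichain (setOfPred_minimal_antichain _)

/-- The differential of the Taylor complex of the monomials `x ^ g 0, …, x ^ g (r - 1)`: with
`m_T = lcm (x ^ g j : j ∈ T)`,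
`d e_T = ∑_{j ∈ T} (-1) ^ #{i ∈ T : i < j} (m_T / m_{T - j}) e_{T - j}`. -/
noncomputable def taylorD (k : Type*) [Field k] {r : ℕ} (g : Fin r → σ →₀ ℕ)
    (T : Finset (Fin r)) : Finset (Fin r) →₀ MvPolynomial σ k :=
  ∑ j ∈ T, Finsupp.single (T.erase j)
    (monomial (T.sup g - (T.erase j).sup g) ((-1 : k) ^ (T.filter (· < j)).card))

lemma taylorD_ne_zero {r : ℕ} (g : Fin r → σ →₀ ℕ) (T U : Finset (Fin r))
    (h : taylorD k g T U ≠ 0) : ∃ j ∈ T, U = T.erase j ∧ taylorD k g T U =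
      monomial (T.sup g - U.sup g) ((-1 : k) ^ (T.filter (· < j)).card) := by
  classical
  have hT : taylorD k g T U = ∑ j ∈ T, if T.erase j = U then
      monomial (T.sup g - (T.erase j).sup g) ((-1 : k) ^ (T.filter (· < j)).card) else 0 := by
    rw [taylorD, Finsupp.finsetSum_apply]
    exact Finset.sum_congr rfl fun j _ => Finsupp.single_apply
  obtain ⟨j, hj, hne⟩ : ∃ j ∈ T, T.erase j = U := by
    by_contra hcon
    push Not at hcon
    exact h (by rw [hT]; exact Finset.sum_eq_zero fun j hj => if_neg (hcon j hj))
  subst hne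
  refine ⟨j, hj, rfl, ?_⟩
  rw [hT, Finset.sum_eq_single j]
  · simp
  · intro i hi hij
    rw [if_neg]
    intro he
    have : i ∈ T.erase j := Finset.mem_erase.2 ⟨hij, hi⟩
    rw [← he] at this
    simp at this
  · exact fun h => absurd hj h

lemma taylorD_comp {r : ℕ} (g : Fin r → σ →₀ ℕ) (T : Finset (Fin r)) :
    Finsupp.linearCombination (MvPolynomial σ k) (taylorD k g) (taylorD k g T) = 0 := by
  classical
  have step : Finsupp.linearCombination (MvPolynomial σ k) (taylorD k g) (taylorD k g T) =
      ∑ j ∈ T, ∑ i ∈ T.erase j, Finsupp.single ((T.erase j).erase i)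
        (monomial (T.sup g - ((T.erase j).erase i).sup g)
          ((-1 : k) ^ (T.filter (· < j)).card * (-1) ^ ((T.erase j).filter (· < i)).card)) := by
    conv_lhs => rw [taylorD]
    rw [map_sum]
    refine Finset.sum_congr rfl fun j hj => ?_
    rw [Finsupp.linearCombination_single, taylorD, Finset.smul_sum]
    refine Finset.sum_congr rfl fun i hi => ?_
    rw [Finsupp.smul_single, smul_eq_mul, monomial_mul]
    congr 3
    apply tsub_add_tsub_cancel
    · exact Finset.sup_mono (Finset.erase_subset _ _)
    · exact Finset.sup_mono (Finset.erase_subset _ _)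
  rw [step, Finset.sum_sigma']
  refine Finset.sum_involution (fun p _ => ⟨p.2, p.1⟩) ?_ ?_ ?_ ?_
  · rintro ⟨j, i⟩ hp
    simp only [Finset.mem_sigma, Finset.mem_erase] at hp
    obtain ⟨hj, hij, hi⟩ := hp
    dsimp only
    rw [Finset.erase_right_comm (a := j) (b := i), ← Finsupp.single_add, ← map_add]
    have hz : ∀ {a b : Fin r}, a < b → a ∈ T → b ∈ T →
        (-1 : k) ^ (T.filter (· < b)).card * (-1) ^ ((T.erase b).filter (· < a)).card +
        (-1 : k) ^ (T.filter (· < a)).card * (-1) ^ ((T.erase a).filter (· < b)).card = 0 := by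
      intro a b hab ha hb
      have h1 : (T.erase b).filter (· < a) = T.filter (· < a) := by
        ext x
        simp only [Finset.mem_filter, Finset.mem_erase]
        constructor
        · rintro ⟨⟨_, h⟩, h'⟩; exact ⟨h, h'⟩
        · rintro ⟨h, h'⟩; exact ⟨⟨(h'.trans hab).ne, h⟩, h'⟩
      have h2 : (T.filter (· < b)).card = ((T.erase a).filter (· < b)).card + 1 := by
        rw [Finset.filter_erase, Finset.card_erase_add_one]
        simp [ha, hab]
      rw [h1, h2, pow_succ]
      ring
    rcases lt_or_gt_of_ne hij with h | h
    · rw [hz h hi hj]; simp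
    · rw [add_comm, hz h hj hi]; simp
  · rintro ⟨j, i⟩ hp _ he
    simp only [Finset.mem_sigma, Finset.mem_erase] at hp
    simp only [Sigma.mk.injEq] at he
    exact hp.2.1 he.1
  · rintro ⟨j, i⟩ hp
    simp only [Finset.mem_sigma, Finset.mem_erase] at hp ⊢
    exact ⟨hp.2.2, hp.2.1.symm, hp.1⟩
  · rintro ⟨j, i⟩ _
    rfl

/-- The Taylor complex of the monomials `x ^ g 0, …, x ^ g (r - 1)`. -/
noncomputable def taylorComplex (k : Type*) [Field k] {r : ℕ} (g : Fin r → σ →₀ ℕ) :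
    GradedFreeComplex k σ where
  basis := Finset (Fin r)
  hdeg T := T.card
  deg T := (T.sup g).degree
  d := taylorD k g
  finite_basis _ := Set.toFinite _
  d_hdeg T U h := by
    obtain ⟨j, hj, rfl, -⟩ := taylorD_ne_zero g T U h
    exact (Finset.card_erase_add_one hj).symm
  d_deg T U h := by
    obtain ⟨j, hj, hU, he⟩ := taylorD_ne_zero g T U h
    have hle : U.sup g ≤ T.sup g := by
      rw [hU]; exact Finset.sup_mono (Finset.erase_subset _ _)
    have hdeg : (T.sup g - U.sup g).degree + (U.sup g).degree = (T.sup g).degree := by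
      rw [← map_add, tsub_add_cancel_of_le hle]
    refine ⟨by omega, ?_⟩
    rw [he]
    exact isHomogeneous_monomial _ (by omega)
  d_comp_d := taylorD_comp g

/-- The Taylor resolution of `S/I`, for a monomial ideal `I`: the Taylor complex of the minimal
monomial generators of `I`, listed in some order. -/
noncomputable def taylorResolution [Finite σ] (I : Ideal (MvPolynomial σ k)) :
    GradedFreeComplex k σ :=
  taylorComplex k fun j => ((gens_finite I).toFinset.equivFin.symm j : σ →₀ ℕ)

end MultiplicityConjecture

/-!
Write `A = S/I`, `B = S'/I'`, with dimensions `D`, `D'` and codimensions `c`, `c'`. The isomorphism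
`A ⊗_k B ≃ S''/(I S'' + I' S'')` (`quotTensorEquiv`) transports everything to tensor products over
the field `k`.

*Invariants.* Noether normalizations of `A` and `B` tensor to one of `A ⊗ B`, so Krull dimension
and codimension are additive (`ringKrullDim_tensorIdeal`). Homogeneous bases tensor to homogeneous
bases, so the Hilbert series, and with it the multiplicity, is multiplicative
(`hilbertSeries_tensorIdeal`, `HasMultiplicity.tensor`).

*Resolutions.* Over `k` a complex that is exact in positive degrees is contractible onto a
projection `p` concentrated in degree `0`. From contractions `h`, `h'` of `F`, `F'` one gets the
contraction `h ⊗ 1 + p ⊗ h'` of `F ⊗ F'` onto `p ⊗ p'`, so `F ⊗ F'` is exact in positive degrees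
(`GradedFreeComplex.IsResolution.tensor`).

*Bounds.* The shifts of `F ⊗ F'` in degree `i` are the sums of shifts in degrees `a`, `b` with
`a + b = i`. Hence the minimal shifts satisfy `m''_{a+b} ≤ m_a + m'_b`, the maximal ones the reverse
inequality, and induction along Pascal's triangle yields
`∏ m''_i ≤ (c + c').choose c * ∏ m_i * ∏ m'_i` (`prod_le_choose_mul_prod`) and its counterpart
for the maximal shifts. Division by `(c + c')!` gives the bounds for `F ⊗ F'`.

*The conjecture.* If `A ⊗ B` is Cohen-Macaulay, then so are `A` and `B`
(`IsCohenMacaulay.of_tensor`), so that their lower bounds are available. Indeed, maximal regular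
sequences of lengths `r ≤ D`, `s ≤ D'` on `A` and `B` leave nonzero socle elements `a`, `b`.
Together they form a regular sequence on `A ⊗ B` by flatness over `k`, and `a ⊗ b` is a nonzero
socle element of what remains. So that sequence cannot be prolonged, and by Rees' theorem no
regular sequence in the ideal of the variables is longer: `D + D' ≤ r + s`.

*Corollaries.* The tensor product of minimal complexes is minimal. For monomial ideals, the minimal
generators of `I S'' + I' S''` are those of `I` together with those of `I'`, so its Taylor
resolution has the same shifts as the tensor product of the Taylor resolutions
(`betti_taylorResolution_tensorIdeal_ne_zero_iff`), and the bounds involve the shifts only.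
-/

namespace MultiplicityConjecture

/-! ### Presentation of the tensor product -/

section TensorAlgebra

variable {k : Type*} [Field k] {σ τ : Type*}

/-- The canonical isomorphism `k[x] ⊗_k k[y] ≃ k[x, y]`, `p ⊗ q ↦ p(x) q(y)`. -/
noncomputable def polyTensorEquiv (k σ τ : Type*) [Field k] :
    (MvPolynomial σ k ⊗[k] MvPolynomial τ k) ≃ₐ[k] MvPolynomial (σ ⊕ τ) k :=
  AlgEquiv.ofAlgHom
    (Algebra.TensorProduct.lift (rename Sum.inl) (rename Sum.inr) fun _ _ => Commute.all _ _)
    (aeval (Sum.elim (fun s => X s ⊗ₜ 1) fun t => 1 ⊗ₜ X t))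
    (by ext i; rcases i with i | i <;> simp)
    (by ext i <;> simp)

@[simp]
lemma polyTensorEquiv_tmul (p : MvPolynomial σ k) (q : MvPolynomial τ k) :
    polyTensorEquiv k σ τ (p ⊗ₜ q) = rename Sum.inl p * rename Sum.inr q := by
  simp [polyTensorEquiv]

variable (I : Ideal (MvPolynomial σ k)) (I' : Ideal (MvPolynomial τ k))

lemma rename_inl_mem_tensorIdeal {I : Ideal (MvPolynomial σ k)} {f : MvPolynomial σ k}
    (hf : f ∈ I) : rename Sum.inl f ∈ tensorIdeal I I' :=
  (le_sup_left : _ ≤ tensorIdeal I I') (Ideal.mem_map_of_mem _ hf)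

lemma rename_inr_mem_tensorIdeal {I' : Ideal (MvPolynomial τ k)} {f : MvPolynomial τ k}
    (hf : f ∈ I') : rename Sum.inr f ∈ tensorIdeal I I' :=
  (le_sup_right : _ ≤ tensorIdeal I I') (Ideal.mem_map_of_mem _ hf)

/-- The canonical map `S/I → S''/(I S'' + I' S'')`. -/
noncomputable def quotInl :
    (MvPolynomial σ k ⧸ I) →ₐ[k] (MvPolynomial (σ ⊕ τ) k ⧸ tensorIdeal I I') :=
  Ideal.Quotient.liftₐ I ((Ideal.Quotient.mkₐ k (tensorIdeal I I')).comp (rename Sum.inl))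
    fun _ hf => Ideal.Quotient.eq_zero_iff_mem.2 (rename_inl_mem_tensorIdeal I' hf)

/-- The canonical map `S'/I' → S''/(I S'' + I' S'')`. -/
noncomputable def quotInr :
    (MvPolynomial τ k ⧸ I') →ₐ[k] (MvPolynomial (σ ⊕ τ) k ⧸ tensorIdeal I I') :=
  Ideal.Quotient.liftₐ I' ((Ideal.Quotient.mkₐ k (tensorIdeal I I')).comp (rename Sum.inr))
    fun _ hf => Ideal.Quotient.eq_zero_iff_mem.2 (rename_inr_mem_tensorIdeal I hf)

/-- The canonical map `S''/(I S'' + I' S'') → (S/I) ⊗_k (S'/I')`. -/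
noncomputable def quotToTensor :
    (MvPolynomial (σ ⊕ τ) k ⧸ tensorIdeal I I') →ₐ[k]
      ((MvPolynomial σ k ⧸ I) ⊗[k] (MvPolynomial τ k ⧸ I')) :=
  Ideal.Quotient.liftₐ (tensorIdeal I I')
    (aeval (R := k) (Sum.elim (fun s => Ideal.Quotient.mk I (X s) ⊗ₜ[k] 1)
      fun t => 1 ⊗ₜ[k] Ideal.Quotient.mk I' (X t))) (by
    set g : MvPolynomial (σ ⊕ τ) k →ₐ[k]
        ((MvPolynomial σ k ⧸ I) ⊗[k] (MvPolynomial τ k ⧸ I')) :=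
      aeval (Sum.elim (fun s => Ideal.Quotient.mk I (X s) ⊗ₜ[k] 1)
        fun t => 1 ⊗ₜ[k] Ideal.Quotient.mk I' (X t)) with hg
    have hl : g.comp (rename Sum.inl) =
        Algebra.TensorProduct.includeLeft.comp (Ideal.Quotient.mkₐ k I) := by
      ext; simp [hg]
    have hr : g.comp (rename Sum.inr) =
        Algebra.TensorProduct.includeRight.comp (Ideal.Quotient.mkₐ k I') := by
      ext; simp [hg]
    change tensorIdeal I I' ≤ RingHom.ker g
    refine sup_le (Ideal.map_le_iff_le_comap.2 fun f hf => ?_)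
      (Ideal.map_le_iff_le_comap.2 fun f hf => ?_)
    · have h : g (rename Sum.inl f) = Ideal.Quotient.mk I f ⊗ₜ[k] 1 := DFunLike.congr_fun hl f
      change g (rename Sum.inl f) = 0
      rw [h, Ideal.Quotient.eq_zero_iff_mem.2 hf, TensorProduct.zero_tmul]
    · have h : g (rename Sum.inr f) = 1 ⊗ₜ[k] Ideal.Quotient.mk I' f := DFunLike.congr_fun hr f
      change g (rename Sum.inr f) = 0
      rw [h, Ideal.Quotient.eq_zero_iff_mem.2 hf, TensorProduct.tmul_zero])

@[simp]
lemma quotInl_mk (f : MvPolynomial σ k) :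
    quotInl I I' (Ideal.Quotient.mk I f) = Ideal.Quotient.mk _ (rename Sum.inl f) := rfl

@[simp]
lemma quotInr_mk (f : MvPolynomial τ k) :
    quotInr I I' (Ideal.Quotient.mk I' f) = Ideal.Quotient.mk _ (rename Sum.inr f) := rfl

@[simp]
lemma quotToTensor_mk (f : MvPolynomial (σ ⊕ τ) k) :
    quotToTensor I I' (Ideal.Quotient.mk _ f) =
      aeval (R := k) (Sum.elim (fun s => Ideal.Quotient.mk I (X s) ⊗ₜ[k] 1)
        fun t => 1 ⊗ₜ[k] Ideal.Quotient.mk I' (X t)) f := rfl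

/-- The canonical isomorphism `(S/I) ⊗_k (S'/I') ≃ S''/(I S'' + I' S'')`. -/
noncomputable def quotTensorEquiv :
    ((MvPolynomial σ k ⧸ I) ⊗[k] (MvPolynomial τ k ⧸ I')) ≃ₐ[k]
      (MvPolynomial (σ ⊕ τ) k ⧸ tensorIdeal I I') :=
  AlgEquiv.ofAlgHom
    (Algebra.TensorProduct.lift (quotInl I I') (quotInr I I') fun _ _ => Commute.all _ _)
    (quotToTensor I I')
    (by
      apply Ideal.Quotient.algHom_ext
      ext i
      rcases i with i | i <;> simp [-Ideal.Quotient.mk_eq_mk])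
    (by
      apply Algebra.TensorProduct.ext
      · apply Ideal.Quotient.algHom_ext
        ext i
        simp
      · apply Ideal.Quotient.algHom_ext
        ext i
        simp)

@[simp]
lemma quotTensorEquiv_tmul (p : MvPolynomial σ k) (q : MvPolynomial τ k) :
    quotTensorEquiv I I' (Ideal.Quotient.mk I p ⊗ₜ Ideal.Quotient.mk I' q) =
      Ideal.Quotient.mk (tensorIdeal I I') (rename Sum.inl p * rename Sum.inr q) := by
  simp [quotTensorEquiv]

/-- Over a field, a pure tensor vanishes only if one of its factors does. -/
lemma tmul_eq_zero_iff_of_field {V W : Type*} [AddCommGroup V] [Module k V] [AddCommGroup W]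
    [Module k W] (v : V) (w : W) : v ⊗ₜ[k] w = 0 ↔ v = 0 ∨ w = 0 := by
  refine ⟨fun h => ?_, fun h => by rcases h with rfl | rfl <;> simp⟩
  by_contra! hcon
  obtain ⟨u, hu⟩ := not_forall.1 (mt (Module.forall_dual_apply_eq_zero_iff k v).1 hcon.1)
  obtain ⟨v', hv'⟩ := not_forall.1 (mt (Module.forall_dual_apply_eq_zero_iff k w).1 hcon.2)
  have := congrArg (fun z => TensorProduct.lid k k (TensorProduct.map u v' z)) h
  simp [hu, hv'] at this

lemma tensorIdeal_isHomogeneous (hI : I.IsHomogeneous (homogeneousSubmodule σ k))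
    (hI' : I'.IsHomogeneous (homogeneousSubmodule τ k)) :
    (tensorIdeal I I').IsHomogeneous (homogeneousSubmodule (σ ⊕ τ) k) := by
  refine Ideal.IsHomogeneous.sup ?_ ?_
  · obtain ⟨s, rfl⟩ := (Ideal.IsHomogeneous.iff_exists _ _).1 hI
    rw [Ideal.map_span]
    refine Ideal.homogeneous_span _ _ ?_
    rintro _ ⟨_, ⟨⟨x, i, hx⟩, -, rfl⟩, rfl⟩
    exact ⟨i, IsHomogeneous.rename_isHomogeneous hx⟩
  · obtain ⟨s, rfl⟩ := (Ideal.IsHomogeneous.iff_exists _ _).1 hI'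
    rw [Ideal.map_span]
    refine Ideal.homogeneous_span _ _ ?_
    rintro _ ⟨_, ⟨⟨x, i, hx⟩, -, rfl⟩, rfl⟩
    exact ⟨i, IsHomogeneous.rename_isHomogeneous hx⟩

/-- Over a field, `x ⊗ y = 0` only if `x = 0` or `y = 0`; so `f(x) g(y)` lies in
`I S'' + I' S''` only if `f ∈ I` or `g ∈ I'`. -/
lemma rename_mul_rename_mem_tensorIdeal_iff (f : MvPolynomial σ k) (g : MvPolynomial τ k) :
    rename Sum.inl f * rename Sum.inr g ∈ tensorIdeal I I' ↔ f ∈ I ∨ g ∈ I' := by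
  rw [← Ideal.Quotient.eq_zero_iff_mem, ← quotTensorEquiv_tmul, EmbeddingLike.map_eq_zero_iff,
    tmul_eq_zero_iff_of_field, Ideal.Quotient.eq_zero_iff_mem,
    Ideal.Quotient.eq_zero_iff_mem]

lemma tensorIdeal_ne_top (hI : I ≠ ⊤) (hI' : I' ≠ ⊤) : tensorIdeal I I' ≠ ⊤ := by
  rw [Ideal.ne_top_iff_one] at *
  have := rename_mul_rename_mem_tensorIdeal_iff I I' 1 1
  simp only [map_one, one_mul] at this
  tauto

end TensorAlgebra

/-! ### Krull dimension of tensor products -/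

section KrullDimension

/-- An injective integral extension preserves the Krull dimension: contraction of primes is
strictly monotone, and chains of primes lift by lying over and going up. -/
lemma ringKrullDim_eq_of_injective_isIntegral {R A : Type*} [CommRing R] [CommRing A] (f : R →+* A)
    (hinj : Function.Injective f) (hint : f.IsIntegral) : ringKrullDim A = ringKrullDim R := by
  let := f.toAlgebra
  have : Algebra.IsIntegral R A := ⟨hint⟩
  have hf : algebraMap R A = f := rfl
  apply le_antisymm
  · refine Order.krullDim_le_of_strictMono (PrimeSpectrum.comap f) fun p q hpq => ?_
    exact Ideal.IsIntegral.comap_lt_comap (R := R) (I := p.asIdeal) (J := q.asIdeal) hpq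
  · refine iSup_le fun l => ?_
    obtain ⟨Q, -, hQ, hQ'⟩ := Ideal.exists_ideal_over_prime_of_isIntegral
      (RelSeries.head l).asIdeal (⊥ : Ideal A) (by
        rw [← RingHom.ker_eq_comap_bot, hf, (RingHom.injective_iff_ker_eq_bot f).1 hinj]
        exact bot_le)
    have : Q.LiesOver (RelSeries.head l).asIdeal := ⟨hQ'.symm⟩
    obtain ⟨L, hL, -⟩ := Ideal.exists_ltSeries_of_hasGoingUp (S := A) l Q
    rw [← hL]
    exact Order.LTSeries.length_le_krullDim L

variable {k : Type*} [Field k]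

lemma ringKrullDim_mvPolynomial_field (σ : Type*) [Finite σ] :
    ringKrullDim (MvPolynomial σ k) = Nat.card σ := by
  simp

/-- The Krull dimension of finitely generated algebras over a field is additive under tensor
products: the tensor product of two Noether normalizations is again one. -/
lemma ringKrullDim_tensorProduct {A B : Type*} [CommRing A] [CommRing B] [Algebra k A]
    [Algebra k B] [Algebra.FiniteType k A] [Algebra.FiniteType k B] [Nontrivial A] [Nontrivial B] :
    ringKrullDim (A ⊗[k] B) = ringKrullDim A + ringKrullDim B := by
  obtain ⟨s, g, hg, hgi⟩ := exists_integral_inj_algHom_of_fg k A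
  obtain ⟨t, h, hh, hhi⟩ := exists_integral_inj_algHom_of_fg k B
  have e1 := ringKrullDim_eq_of_injective_isIntegral g.toRingHom hg hgi
  have e2 := ringKrullDim_eq_of_injective_isIntegral h.toRingHom hh hhi
  have e3 := ringKrullDim_eq_of_injective_isIntegral
    (Algebra.TensorProduct.map g h).toRingHom (by
      exact TensorProduct.map_injective_of_flat_flat g.toLinearMap h.toLinearMap hg hh)
    (by
      intro x
      induction x with
      | zero => exact RingHom.isIntegralElem_zero _
      | add x y hx hy => exact RingHom.IsIntegralElem.add _ hx hy
      | tmul x y =>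
        rw [← mul_one x, ← one_mul y, ← Algebra.TensorProduct.tmul_mul_tmul]
        refine RingHom.IsIntegralElem.mul _ ?_ ?_
        · refine RingHom.IsIntegralElem.of_comp
            (f := (Algebra.TensorProduct.includeLeft : _ →ₐ[k] _).toRingHom) ?_
          have : (Algebra.TensorProduct.map g h).toRingHom.comp
              (Algebra.TensorProduct.includeLeft : _ →ₐ[k] _).toRingHom =
              (Algebra.TensorProduct.includeLeft : A →ₐ[k] A ⊗[k] B).toRingHom.comp
                g.toRingHom := RingHom.ext fun z => by simp
          rw [this]
          exact RingHom.IsIntegralElem.map (hgi x) _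
        · refine RingHom.IsIntegralElem.of_comp
            (f := (Algebra.TensorProduct.includeRight : _ →ₐ[k] _).toRingHom) ?_
          have : (Algebra.TensorProduct.map g h).toRingHom.comp
              (Algebra.TensorProduct.includeRight : _ →ₐ[k] _).toRingHom =
              (Algebra.TensorProduct.includeRight : B →ₐ[k] A ⊗[k] B).toRingHom.comp
                h.toRingHom := RingHom.ext fun z => by simp
          rw [this]
          exact RingHom.IsIntegralElem.map (hhi y) _)
  rw [e1, e2, e3,
    ← ringKrullDim_eq_of_ringEquiv (polyTensorEquiv k (Fin s) (Fin t)).symm.toRingEquiv,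
    ringKrullDim_mvPolynomial_field, ringKrullDim_mvPolynomial_field,
    ringKrullDim_mvPolynomial_field, Nat.card_sum]
  simp

lemma ringKrullDim_tensorIdeal {σ τ : Type*} [Finite σ] [Finite τ] {I : Ideal (MvPolynomial σ k)}
    {I' : Ideal (MvPolynomial τ k)} (hI : I ≠ ⊤) (hI' : I' ≠ ⊤) :
    ringKrullDim (MvPolynomial (σ ⊕ τ) k ⧸ tensorIdeal I I') =
      ringKrullDim (MvPolynomial σ k ⧸ I) + ringKrullDim (MvPolynomial τ k ⧸ I') := by
  have := Ideal.Quotient.nontrivial_iff.2 hI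
  have := Ideal.Quotient.nontrivial_iff.2 hI'
  rw [← ringKrullDim_tensorProduct (k := k)]
  exact (ringKrullDim_eq_of_ringEquiv (quotTensorEquiv I I').toRingEquiv).symm

end KrullDimension

/-! ### Inequalities between products of shifts -/

section ShiftInequalities

/-- If `m'' (a + b) ≤ m a + m' b` for all `a ≤ c`, `b ≤ c'`, with `m 0 = m' 0 = 0`, then
`∏ m'' ≤ (c + c').choose c * ∏ m * ∏ m'`: estimate the last factor by `m c + m' c'` and use
Pascal's rule. -/
lemma prod_le_choose_mul_prod (m m' m'' : ℕ → ℕ) (h0 : m 0 = 0) (h0' : m' 0 = 0) (c c' : ℕ)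
    (h : ∀ a b, a ≤ c → b ≤ c' → m'' (a + b) ≤ m a + m' b) :
    ∏ i ∈ Finset.Icc 1 (c + c'), m'' i ≤
      (c + c').choose c * ((∏ i ∈ Finset.Icc 1 c, m i) * ∏ i ∈ Finset.Icc 1 c', m' i) := by
  induction c generalizing c' with
  | zero =>
    simp only [zero_add, Nat.choose_zero_right, one_mul, Finset.Icc_eq_empty_of_lt zero_lt_one,
      Finset.prod_empty]
    refine Finset.prod_le_prod' fun i hi => ?_
    simpa [h0] using h 0 i le_rfl (Finset.mem_Icc.1 hi).2
  | succ c ih =>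
    induction c' with
    | zero =>
      simp only [add_zero, Nat.choose_self, one_mul, Finset.Icc_eq_empty_of_lt zero_lt_one,
        Finset.prod_empty, mul_one]
      refine Finset.prod_le_prod' fun i hi => ?_
      simpa [h0'] using h i 0 (Finset.mem_Icc.1 hi).2 le_rfl
    | succ c' ih' =>
      have h1 := ih (c' + 1) fun a b ha hb => h a b (by omega) hb
      have h2 := ih' fun a b ha hb => h a b ha (by omega)
      have hlast := h (c + 1) (c' + 1) le_rfl le_rfl
      rw [show c + 1 + (c' + 1) = (c + c' + 1) + 1 by ring] at *
      rw [show c + (c' + 1) = c + c' + 1 by ring] at h1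
      rw [show c + 1 + c' = c + c' + 1 by ring] at h2
      rw [Finset.prod_Icc_succ_top (by omega : 1 ≤ c + c' + 1 + 1)]
      rw [Finset.prod_Icc_succ_top (by omega : 1 ≤ c + 1)] at h2 ⊢
      rw [Finset.prod_Icc_succ_top (by omega : 1 ≤ c' + 1)] at h1 ⊢
      rw [Nat.choose_succ_succ']
      refine (Nat.mul_le_mul_left _ hlast).trans ?_
      rw [mul_add, add_mul]
      refine add_le_add ((Nat.mul_le_mul_right _ h1).trans_eq ?_)
        ((Nat.mul_le_mul_right _ h2).trans_eq ?_) <;> ring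

/-- The analogue of `prod_le_choose_mul_prod` for maximal shifts. -/
lemma choose_mul_prod_le_prod (m m' m'' : ℕ → ℕ) (c c' : ℕ)
    (h : ∀ a b, a ≤ c → b ≤ c' → m a + m' b ≤ m'' (a + b)) :
    (c + c').choose c * ((∏ i ∈ Finset.Icc 1 c, m i) * ∏ i ∈ Finset.Icc 1 c', m' i) ≤
      ∏ i ∈ Finset.Icc 1 (c + c'), m'' i := by
  induction c generalizing c' with
  | zero =>
    simp only [zero_add, Nat.choose_zero_right, one_mul, Finset.Icc_eq_empty_of_lt zero_lt_one,
      Finset.prod_empty]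
    refine Finset.prod_le_prod' fun i hi => ?_
    have := h 0 i le_rfl (Finset.mem_Icc.1 hi).2
    rw [zero_add] at this
    omega
  | succ c ih =>
    induction c' with
    | zero =>
      simp only [add_zero, Nat.choose_self, one_mul, Finset.Icc_eq_empty_of_lt zero_lt_one,
        Finset.prod_empty, mul_one]
      refine Finset.prod_le_prod' fun i hi => ?_
      have := h i 0 (Finset.mem_Icc.1 hi).2 le_rfl
      rw [add_zero] at this
      omega
    | succ c' ih' =>
      have h1 := ih (c' + 1) fun a b ha hb => h a b (by omega) hb
      have h2 := ih' fun a b ha hb => h a b ha (by omega)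
      have hlast := h (c + 1) (c' + 1) le_rfl le_rfl
      rw [show c + 1 + (c' + 1) = (c + c' + 1) + 1 by ring] at *
      rw [show c + (c' + 1) = c + c' + 1 by ring] at h1
      rw [show c + 1 + c' = c + c' + 1 by ring] at h2
      rw [Finset.prod_Icc_succ_top (by omega : 1 ≤ c + c' + 1 + 1)]
      rw [Finset.prod_Icc_succ_top (by omega : 1 ≤ c + 1)] at h2 ⊢
      rw [Finset.prod_Icc_succ_top (by omega : 1 ≤ c' + 1)] at h1 ⊢
      rw [Nat.choose_succ_succ']
      refine le_trans ?_ (Nat.mul_le_mul_left _ hlast)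
      rw [mul_add, add_mul]
      refine add_le_add (le_trans (le_of_eq ?_) (Nat.mul_le_mul_right _ h1))
        (le_trans (le_of_eq ?_) (Nat.mul_le_mul_right _ h2)) <;> ring

end ShiftInequalities

/-! ### Hilbert series of tensor products -/

section HilbertSeries

variable {k : Type*} [Field k] {σ τ : Type*}

lemma exists_eq_mapDomain_inl_add_mapDomain_inr {σ τ : Type*} (s : σ ⊕ τ →₀ ℕ) :
    ∃ (a : σ →₀ ℕ) (b : τ →₀ ℕ), s = a.mapDomain Sum.inl + b.mapDomain Sum.inr := by
  induction s using Finsupp.induction_linear with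
  | zero => exact ⟨0, 0, by simp⟩
  | add s t hs ht =>
    obtain ⟨a, b, rfl⟩ := hs
    obtain ⟨a', b', rfl⟩ := ht
    refine ⟨a + a', b + b', ?_⟩
    rw [Finsupp.mapDomain_add, Finsupp.mapDomain_add]
    abel
  | single i n =>
    rcases i with i | i
    · exact ⟨Finsupp.single i n, 0, by simp⟩
    · exact ⟨0, Finsupp.single i n, by simp⟩

/-- The graded piece `(S/I)_d`. -/
noncomputable def quotPiece (I : Ideal (MvPolynomial σ k)) (d : ℕ) :
    Submodule k (MvPolynomial σ k ⧸ I) :=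
  (homogeneousSubmodule σ k d).map (Ideal.Quotient.mkₐ k I).toLinearMap

lemma mem_quotPiece {I : Ideal (MvPolynomial σ k)} {d : ℕ} {x : MvPolynomial σ k ⧸ I} :
    x ∈ quotPiece I d ↔ ∃ f : MvPolynomial σ k, f.IsHomogeneous d ∧ Ideal.Quotient.mk I f = x :=
  Iff.rfl

lemma homogeneousComponent_mem {I : Ideal (MvPolynomial σ k)}
    (hI : I.IsHomogeneous (homogeneousSubmodule σ k)) {f : MvPolynomial σ k} (hf : f ∈ I) (d : ℕ) :
    homogeneousComponent d f ∈ I := by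
  rw [← decomposition.decompose'_apply]
  exact hI d hf

lemma quotPiece_isInternal {I : Ideal (MvPolynomial σ k)}
    (hI : I.IsHomogeneous (homogeneousSubmodule σ k)) : DirectSum.IsInternal (quotPiece I) := by
  apply DirectSum.isInternal_submodule_of_iSupIndep_of_iSup_eq_top
  · rw [iSupIndep_iff_finsetSum_eq_zero_imp_eq_zero]
    intro s v hv hsum i hi
    choose! f hf using fun i hi => mem_quotPiece.1 (hv i hi)
    have h1 : ∑ i ∈ s, f i ∈ I := by
      rw [← Ideal.Quotient.eq_zero_iff_mem, map_sum, ← hsum]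
      exact Finset.sum_congr rfl fun i hi => (hf i hi).2
    have h2 := homogeneousComponent_mem hI h1 i
    rw [map_sum, Finset.sum_eq_single i, homogeneousComponent_of_mem (hf i hi).1, if_pos rfl] at h2
    · rw [← (hf i hi).2, Ideal.Quotient.eq_zero_iff_mem.2 h2]
    · intro j hj hji
      rw [homogeneousComponent_of_mem (hf j hj).1, if_neg hji.symm]
    · exact fun h => absurd hi h
  · rw [eq_top_iff]
    rintro x -
    obtain ⟨f, rfl⟩ := Ideal.Quotient.mk_surjective x
    rw [← sum_homogeneousComponent f, map_sum]
    exact Submodule.sum_mem _ fun i _ => Submodule.mem_iSup_of_mem i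
      (mem_quotPiece.2 ⟨_, homogeneousComponent_isHomogeneous i f, rfl⟩)

instance [Finite σ] (I : Ideal (MvPolynomial σ k)) (d : ℕ) : Module.Finite k (quotPiece I d) := by
  have : Module.Finite k (homogeneousSubmodule σ k d) :=
    Module.Finite.iff_fg.2 (homogeneousSubmodule_fg σ k d)
  unfold quotPiece
  infer_instance

/-- A `k`-basis `v` of `S/I` is homogeneous, with degrees `δ`, if each graded piece is spanned by
the finitely many basis elements of that degree. -/
def IsHomogeneousBasis {I : Ideal (MvPolynomial σ k)} {ι : Type*}
    (v : Module.Basis ι k (MvPolynomial σ k ⧸ I)) (δ : ι → ℕ) : Prop :=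
  ∀ d, {i | δ i = d}.Finite ∧ quotPiece I d = Submodule.span k (v '' {i | δ i = d})

lemma exists_isHomogeneousBasis [Finite σ] {I : Ideal (MvPolynomial σ k)}
    (hI : I.IsHomogeneous (homogeneousSubmodule σ k)) :
    ∃ (ι : Type) (v : Module.Basis ι k (MvPolynomial σ k ⧸ I)) (δ : ι → ℕ),
      IsHomogeneousBasis v δ := by
  let b := fun d => Module.finBasis k (quotPiece I d)
  let v := (quotPiece_isInternal hI).collectedBasis b
  have himage : ∀ d, (fun j => (⟨d, j⟩ : Σ i, Fin (Module.finrank k (quotPiece I i)))) '' Set.univ =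
      {i : Σ i, Fin (Module.finrank k (quotPiece I i)) | i.1 = d} := by
    intro d
    ext ⟨e, j⟩
    constructor
    · rintro ⟨j', -, h⟩
      exact (congrArg Sigma.fst h).symm
    · rintro rfl
      exact ⟨j, trivial, rfl⟩
  refine ⟨_, v, Sigma.fst, fun d => ⟨?_, ?_⟩⟩
  · rw [← himage]
    exact Set.finite_univ.image _
  · rw [← himage, ← Set.image_comp, Set.image_univ]
    have : (v ∘ fun j => (⟨d, j⟩ : Σ i, Fin (Module.finrank k (quotPiece I i)))) =
        (quotPiece I d).subtype ∘ b d := by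
      ext j
      simp [v]
    rw [this, Set.range_comp, Submodule.span_image, (b d).span_eq, Submodule.map_top,
      Submodule.range_subtype]

lemma IsHomogeneousBasis.coeff_hilbertSeries {I : Ideal (MvPolynomial σ k)} {ι : Type*}
    {v : Module.Basis ι k (MvPolynomial σ k ⧸ I)} {δ : ι → ℕ} (h : IsHomogeneousBasis v δ) (d : ℕ) :
    PowerSeries.coeff d (hilbertSeries I) = ({i | δ i = d}.ncard : ℤ) := by
  have h1 : PowerSeries.coeff d (hilbertSeries I) = (Module.finrank k (quotPiece I d) : ℤ) := by
    rw [hilbertSeries, PowerSeries.coeff_mk]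
    rfl
  have hli : LinearIndependent k fun i : {i | δ i = d} => v i :=
    v.linearIndependent.comp _ Subtype.val_injective
  rw [h1, (h d).2, Set.image_eq_range, Module.finrank_eq_nat_card_basis (Module.Basis.span hli),
    Nat.card_coe_set_eq]

/-- Tensor products of homogeneous bases are homogeneous bases. -/
lemma IsHomogeneousBasis.tensor {I : Ideal (MvPolynomial σ k)} {I' : Ideal (MvPolynomial τ k)}
    {ι ι' : Type*}
    {v : Module.Basis ι k (MvPolynomial σ k ⧸ I)} {δ : ι → ℕ} (h : IsHomogeneousBasis v δ)
    {v' : Module.Basis ι' k (MvPolynomial τ k ⧸ I')} {δ' : ι' → ℕ} (h' : IsHomogeneousBasis v' δ') :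
    IsHomogeneousBasis ((v.tensorProduct v').map (quotTensorEquiv I I').toLinearEquiv)
      (fun p => δ p.1 + δ' p.2) := by
  intro d
  constructor
  · refine Set.Finite.subset (Set.Finite.prod
      (Set.Finite.biUnion (Set.finite_Iic d) fun j _ => (h j).1)
      (Set.Finite.biUnion (Set.finite_Iic d) fun j _ => (h' j).1)) ?_
    rintro ⟨a, b⟩ hab
    simp only [Set.mem_ofPred_eq] at hab
    simp only [Set.mem_prod, Set.mem_iUnion, Set.mem_Iic, Set.mem_ofPred_eq, exists_prop]
    exact ⟨⟨_, by omega, rfl⟩, ⟨_, by omega, rfl⟩⟩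
  · apply le_antisymm
    · rintro _ ⟨F, hF, rfl⟩
      have hmon : ∀ s ∈ F.support, s.degree = d := fun s hs => by
        have h1 : s.degree = d := by
          by_contra hne
          exact mem_support_iff.1 hs (IsHomogeneous.coeff_eq_zero hF hne)
        exact h1
      rw [F.as_sum, map_sum]
      refine Submodule.sum_mem _ fun s hs => ?_
      -- a monomial in the variables `x, y` is a product of a monomial in `x` and one in `y`
      obtain ⟨f, g, p, q, hf, hg, hpq, hfg⟩ : ∃ (f : MvPolynomial σ k) (g : MvPolynomial τ k)
          (p q : ℕ), f.IsHomogeneous p ∧ g.IsHomogeneous q ∧ p + q = d ∧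
          monomial s (coeff s F) = rename Sum.inl f * rename Sum.inr g := by
        obtain ⟨a, b, hab⟩ := exists_eq_mapDomain_inl_add_mapDomain_inr s
        refine ⟨monomial a (coeff s F), monomial b 1, a.degree, b.degree,
          isHomogeneous_monomial _ rfl, isHomogeneous_monomial _ rfl, ?_, ?_⟩
        · rw [← hmon s hs, hab, map_add, Finsupp.degree_mapDomain, Finsupp.degree_mapDomain]
        · rw [rename_monomial, rename_monomial, monomial_mul, mul_one, ← hab]
      have h3 : (Ideal.Quotient.mkₐ k (tensorIdeal I I')).toLinearMap (monomial s (coeff s F)) =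
          quotTensorEquiv I I' (Ideal.Quotient.mk I f ⊗ₜ Ideal.Quotient.mk I' g) := by
        rw [quotTensorEquiv_tmul, hfg]
        rfl
      rw [h3]
      have hf' : Ideal.Quotient.mk I f ∈ quotPiece I p := mem_quotPiece.2 ⟨f, hf, rfl⟩
      have hg' : Ideal.Quotient.mk I' g ∈ quotPiece I' q := mem_quotPiece.2 ⟨g, hg, rfl⟩
      rw [(h p).2] at hf'
      rw [(h' q).2] at hg'
      have hmem := Submodule.apply_mem_map₂ (TensorProduct.mk k _ _) hf' hg'
      rw [Submodule.map₂_span_span] at hmem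
      have h4 := Submodule.mem_map_of_mem (f := (quotTensorEquiv I I').toLinearMap) hmem
      rw [Submodule.map_span] at h4
      refine Submodule.span_mono ?_ h4
      rintro _ ⟨_, ⟨_, ⟨i, hi, rfl⟩, _, ⟨j, hj, rfl⟩, rfl⟩, rfl⟩
      have hi' : δ i = p := hi
      have hj' : δ' j = q := hj
      exact ⟨(i, j), by simp [hi', hj', hpq], by simp⟩
    · rw [Submodule.span_le]
      rintro _ ⟨⟨i, j⟩, hij, rfl⟩
      have hi : v i ∈ quotPiece I (δ i) := by
        rw [(h _).2]; exact Submodule.subset_span ⟨i, rfl, rfl⟩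
      have hj : v' j ∈ quotPiece I' (δ' j) := by
        rw [(h' _).2]; exact Submodule.subset_span ⟨j, rfl, rfl⟩
      obtain ⟨f, hf, hfi⟩ := mem_quotPiece.1 hi
      obtain ⟨g, hg, hgj⟩ := mem_quotPiece.1 hj
      refine mem_quotPiece.2 ⟨rename Sum.inl f * rename Sum.inr g, ?_, ?_⟩
      · have h3 := (hf.rename_isHomogeneous (f := (Sum.inl : σ → σ ⊕ τ))).mul
          (hg.rename_isHomogeneous (f := (Sum.inr : τ → σ ⊕ τ)))
        have hij' : δ i + δ' j = d := hij
        rwa [hij'] at h3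
      · rw [← quotTensorEquiv_tmul, hfi, hgj]
        simp

lemma hilbertSeries_tensorIdeal [Finite σ] [Finite τ] {I : Ideal (MvPolynomial σ k)}
    {I' : Ideal (MvPolynomial τ k)} (hI : I.IsHomogeneous (homogeneousSubmodule σ k))
    (hI' : I'.IsHomogeneous (homogeneousSubmodule τ k)) :
    hilbertSeries (tensorIdeal I I') = hilbertSeries I * hilbertSeries I' := by
  classical
  obtain ⟨ι, v, δ, h⟩ := exists_isHomogeneousBasis hI
  obtain ⟨ι', v', δ', h'⟩ := exists_isHomogeneousBasis hI'
  ext d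
  rw [(h.tensor h').coeff_hilbertSeries, PowerSeries.coeff_mul]
  simp only [h.coeff_hilbertSeries, h'.coeff_hilbertSeries]
  have : {p : ι × ι' | δ p.1 + δ' p.2 = d} =
      (((Finset.HasAntidiagonal.antidiagonal d).biUnion fun q =>
        (h q.1).1.toFinset ×ˢ (h' q.2).1.toFinset : Finset (ι × ι')) : Set (ι × ι')) := by
    ext ⟨i, j⟩
    simp
  rw [this, Set.ncard_coe_finset, Finset.card_biUnion]
  · push_cast
    refine Finset.sum_congr rfl fun q _ => ?_
    rw [Finset.card_product, Set.ncard_eq_toFinset_card _ (h q.1).1,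
      Set.ncard_eq_toFinset_card _ (h' q.2).1]
    push_cast
    rfl
  · intro q _ q' _ hqq'
    refine Finset.disjoint_left.2 ?_
    rintro ⟨i, j⟩ h1 h2
    simp only [Finset.mem_product, Set.Finite.mem_toFinset, Set.mem_ofPred_eq] at h1 h2
    exact hqq' (Prod.ext (h1.1.symm.trans h2.1) (h1.2.symm.trans h2.2))

end HilbertSeries

/-! ### Codimension and multiplicity of tensor products -/

section Multiplicity

variable {k : Type*} [Field k] {σ τ : Type*}

/-- The unit ideal has no codimension, as the zero ring has Krull dimension `⊥`. -/
lemma ne_top_of_hasCodim {I : Ideal (MvPolynomial σ k)} {c : ℕ} (h : HasCodim I c) : I ≠ ⊤ := by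
  rintro rfl
  have : Subsingleton (MvPolynomial σ k ⧸ (⊤ : Ideal (MvPolynomial σ k))) :=
    Ideal.Quotient.subsingleton_iff.2 rfl
  rw [HasCodim, ringKrullDim_eq_bot_of_subsingleton, WithBot.bot_add] at h
  exact WithBot.bot_ne_coe (a := (Nat.card σ : ℕ∞)) h

variable [Finite σ] [Finite τ]

lemma HasCodim.tensor {I : Ideal (MvPolynomial σ k)} {I' : Ideal (MvPolynomial τ k)} {c c' : ℕ}
    (h : HasCodim I c) (h' : HasCodim I' c') : HasCodim (tensorIdeal I I') (c + c') := by
  have h1 := ringKrullDim_tensorIdeal (ne_top_of_hasCodim h) (ne_top_of_hasCodim h')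
  unfold HasCodim at *
  rw [h1, Nat.card_sum, Nat.cast_add, Nat.cast_add, ← h, ← h']
  abel

lemma HasMultiplicity.tensor {I : Ideal (MvPolynomial σ k)} {I' : Ideal (MvPolynomial τ k)}
    (hI : I.IsHomogeneous (homogeneousSubmodule σ k))
    (hI' : I'.IsHomogeneous (homogeneousSubmodule τ k)) (hne : I ≠ ⊤) (hne' : I' ≠ ⊤) {e e' : ℕ}
    (h : HasMultiplicity I e) (h' : HasMultiplicity I' e') :
    HasMultiplicity (tensorIdeal I I') (e * e') := by
  obtain ⟨D, hD, Q, hQ, hQe⟩ := h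
  obtain ⟨D', hD', Q', hQ', hQe'⟩ := h'
  refine ⟨D + D', ?_, Q * Q', ?_, ?_⟩
  · rw [ringKrullDim_tensorIdeal hne hne', hD, hD']
    simp
  · rw [Polynomial.coe_mul, hQ, hQ', hilbertSeries_tensorIdeal hI hI', pow_add]
    ring
  · rw [Polynomial.eval_mul, hQe, hQe']
    simp

end Multiplicity

/-! ### The bounds for the tensor product of two complexes -/

section Bounds

open GradedFreeComplex

variable {k : Type*} [Field k] {σ τ : Type*}

lemma betti_ne_zero_iff {F : GradedFreeComplex k σ} {i j : ℕ} :
    F.betti i j ≠ 0 ↔ ∃ b, F.hdeg b = i ∧ F.deg b = j := by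
  rw [betti, ne_eq, Set.ncard_eq_zero ((F.finite_basis i).subset fun b hb => hb.1),
    ← ne_eq, ← Set.nonempty_iff_ne_empty]
  rfl

lemma betti_tensor_ne_zero_iff {F : GradedFreeComplex k σ} {F' : GradedFreeComplex k τ} {i j : ℕ} :
    (F.tensor F').betti i j ≠ 0 ↔ ∃ a b : ℕ × ℕ, a.1 + b.1 = i ∧ a.2 + b.2 = j ∧
      F.betti a.1 a.2 ≠ 0 ∧ F'.betti b.1 b.2 ≠ 0 := by
  simp only [betti_ne_zero_iff]
  constructor
  · rintro ⟨⟨b, b'⟩, h1, h2⟩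
    exact ⟨(_, _), (_, _), h1, h2, ⟨b, rfl, rfl⟩, ⟨b', rfl, rfl⟩⟩
  · rintro ⟨⟨a1, a2⟩, ⟨b1, b2⟩, rfl, rfl, ⟨b, rfl, rfl⟩, ⟨b', rfl, rfl⟩⟩
    exact ⟨(b, b'), rfl, rfl⟩

lemma finite_setOf_betti_ne_zero (F : GradedFreeComplex k σ) (i : ℕ) :
    {j | F.betti i j ≠ 0}.Finite := by
  refine ((F.finite_basis i).image F.deg).subset fun j hj => ?_
  obtain ⟨b, hb, hb'⟩ := betti_ne_zero_iff.1 hj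
  exact ⟨b, hb, hb'⟩

/-- The module in homological degree `0` is `S`, generated in degree `0`; the only property of a
resolution that the comparison of shifts uses. -/
def StartsInDegreeZero (F : GradedFreeComplex k σ) : Prop :=
  ∀ j, F.betti 0 j ≠ 0 ↔ j = 0

lemma _root_.GradedFreeComplex.IsResolution.startsInDegreeZero {F : GradedFreeComplex k σ}
    {I : Ideal (MvPolynomial σ k)} (h : F.IsResolution I) : StartsInDegreeZero F := by
  obtain ⟨⟨b₀, hb, hdeg, -⟩, -⟩ := h
  intro j
  rw [betti_ne_zero_iff]
  have hiff : ∀ b, F.hdeg b = 0 ↔ b = b₀ := fun b => by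
    simpa using Set.ext_iff.1 hb b
  constructor
  · rintro ⟨b, h1, rfl⟩
    rw [(hiff b).1 h1, hdeg]
  · rintro rfl
    exact ⟨b₀, (hiff _).2 rfl, hdeg⟩

/-- The bounds depend only on the set of shifts of a complex, that is, on the vanishing of its
graded Betti numbers. -/
lemma satisfiesLowerBound_congr {F G : GradedFreeComplex k σ} {I : Ideal (MvPolynomial σ k)}
    (h : ∀ i j, F.betti i j ≠ 0 ↔ G.betti i j ≠ 0) :
    SatisfiesLowerBound F I ↔ SatisfiesLowerBound G I := by
  simp only [SatisfiesLowerBound, IsMinShift, h]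

lemma satisfiesUpperBound_congr {F G : GradedFreeComplex k σ} {I : Ideal (MvPolynomial σ k)}
    (h : ∀ i j, F.betti i j ≠ 0 ↔ G.betti i j ≠ 0) :
    SatisfiesUpperBound F I ↔ SatisfiesUpperBound G I := by
  simp only [SatisfiesUpperBound, IsMaxShift, h]

/-- Adjoin to a sequence of shifts `m 1, …, m c` the shift `0` in homological degree `0`. -/
lemma betti_shift_ne_zero {F : GradedFreeComplex k σ} (h0 : StartsInDegreeZero F) {c : ℕ}
    {m : ℕ → ℕ} (hm : ∀ i ∈ Finset.Icc 1 c, F.betti i (m i) ≠ 0) {a : ℕ} (ha : a ≤ c) :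
    F.betti a (if a = 0 then 0 else m a) ≠ 0 := by
  split_ifs with h
  · rw [h, h0]
  · exact hm a (Finset.mem_Icc.2 ⟨by omega, ha⟩)

variable [Finite σ] [Finite τ]

lemma SatisfiesLowerBound.tensor {I : Ideal (MvPolynomial σ k)} {I' : Ideal (MvPolynomial τ k)}
    (hI : I.IsHomogeneous (homogeneousSubmodule σ k))
    (hI' : I'.IsHomogeneous (homogeneousSubmodule τ k))
    {F : GradedFreeComplex k σ} {F' : GradedFreeComplex k τ}
    (h0 : StartsInDegreeZero F) (h0' : StartsInDegreeZero F')
    (h : SatisfiesLowerBound F I) (h' : SatisfiesLowerBound F' I') :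
    SatisfiesLowerBound (F.tensor F') (tensorIdeal I I') := by
  obtain ⟨c, e, m, hc, he, hm, hle⟩ := h
  obtain ⟨c', e', m', hc', he', hm', hle'⟩ := h'
  let n : ℕ → ℕ := fun a => if a = 0 then 0 else m a
  let n' : ℕ → ℕ := fun a => if a = 0 then 0 else m' a
  have hn : ∀ a b, a ≤ c → b ≤ c' → (F.tensor F').betti (a + b) (n a + n' b) ≠ 0 :=
    fun a b ha hb => betti_tensor_ne_zero_iff.2 ⟨(a, n a), (b, n' b), rfl, rfl,
      betti_shift_ne_zero h0 (fun i hi => (hm i hi).1) ha,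
      betti_shift_ne_zero h0' (fun i hi => (hm' i hi).1) hb⟩
  have hex : ∀ i ≤ c + c', ∃ j, (F.tensor F').IsMinShift i j := by
    intro i hi
    have hne : {j | (F.tensor F').betti i j ≠ 0}.Nonempty := by
      have := hn (min i c) (i - min i c) (by omega) (by omega)
      rw [show min i c + (i - min i c) = i by omega] at this
      exact ⟨_, this⟩
    exact ⟨_, Nat.sInf_mem hne, fun j hj => Nat.sInf_le hj⟩
  choose! m'' hm'' using hex
  refine ⟨c + c', e * e', m'', hc.tensor hc',
    he.tensor hI hI' (ne_top_of_hasCodim hc) (ne_top_of_hasCodim hc') he',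
    fun i hi => hm'' i (Finset.mem_Icc.1 hi).2, ?_⟩
  have key := prod_le_choose_mul_prod n n' m'' rfl rfl c c' fun a b ha hb =>
    (hm'' (a + b) (by omega)).2 (hn a b ha hb)
  have e1 : ∏ i ∈ Finset.Icc 1 c, n i = ∏ i ∈ Finset.Icc 1 c, m i :=
    Finset.prod_congr rfl fun i hi => if_neg (by have := Finset.mem_Icc.1 hi; omega)
  have e2 : ∏ i ∈ Finset.Icc 1 c', n' i = ∏ i ∈ Finset.Icc 1 c', m' i :=
    Finset.prod_congr rfl fun i hi => if_neg (by have := Finset.mem_Icc.1 hi; omega)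
  rw [e1, e2] at key
  have key' : (∏ i ∈ Finset.Icc 1 (c + c'), (m'' i : ℚ)) ≤ ((c + c').choose c : ℚ) *
      ((∏ i ∈ Finset.Icc 1 c, (m i : ℚ)) * ∏ i ∈ Finset.Icc 1 c', (m' i : ℚ)) := by
    exact_mod_cast key
  have hf : ((c + c').choose c : ℚ) * (c ! : ℚ) * (c' ! : ℚ) = ((c + c')! : ℚ) := by
    rw [Nat.choose_symm_add]
    exact_mod_cast Nat.add_choose_mul_factorial_mul_factorial c c'
  calc _ ≤ (((c + c').choose c : ℚ) * ((∏ i ∈ Finset.Icc 1 c, (m i : ℚ)) *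
        ∏ i ∈ Finset.Icc 1 c', (m' i : ℚ))) / ((c + c')! : ℚ) := by gcongr
    _ = ((∏ i ∈ Finset.Icc 1 c, (m i : ℚ)) / (c ! : ℚ)) *
        ((∏ i ∈ Finset.Icc 1 c', (m' i : ℚ)) / (c' ! : ℚ)) := by
      rw [← hf]
      have h1 : ((c + c').choose c : ℚ) ≠ 0 := by
        exact_mod_cast (Nat.choose_pos (Nat.le_add_right c c')).ne'
      have h2 : (c ! : ℚ) ≠ 0 := by exact_mod_cast c.factorial_ne_zero
      have h3 : (c' ! : ℚ) ≠ 0 := by exact_mod_cast c'.factorial_ne_zero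
      field_simp
    _ ≤ (e : ℚ) * (e' : ℚ) := by gcongr
    _ = ((e * e' : ℕ) : ℚ) := by push_cast; rfl

lemma SatisfiesUpperBound.tensor {I : Ideal (MvPolynomial σ k)} {I' : Ideal (MvPolynomial τ k)}
    (hI : I.IsHomogeneous (homogeneousSubmodule σ k))
    (hI' : I'.IsHomogeneous (homogeneousSubmodule τ k))
    {F : GradedFreeComplex k σ} {F' : GradedFreeComplex k τ}
    (h0 : StartsInDegreeZero F) (h0' : StartsInDegreeZero F')
    (h : SatisfiesUpperBound F I) (h' : SatisfiesUpperBound F' I') :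
    SatisfiesUpperBound (F.tensor F') (tensorIdeal I I') := by
  obtain ⟨c, e, m, hc, he, hm, hle⟩ := h
  obtain ⟨c', e', m', hc', he', hm', hle'⟩ := h'
  let n : ℕ → ℕ := fun a => if a = 0 then 0 else m a
  let n' : ℕ → ℕ := fun a => if a = 0 then 0 else m' a
  have hn : ∀ a b, a ≤ c → b ≤ c' → (F.tensor F').betti (a + b) (n a + n' b) ≠ 0 :=
    fun a b ha hb => betti_tensor_ne_zero_iff.2 ⟨(a, n a), (b, n' b), rfl, rfl,
      betti_shift_ne_zero h0 (fun i hi => (hm i hi).1) ha,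
      betti_shift_ne_zero h0' (fun i hi => (hm' i hi).1) hb⟩
  have hex : ∀ i ≤ c + c', ∃ j, (F.tensor F').IsMaxShift i j := by
    intro i hi
    have hne : {j | (F.tensor F').betti i j ≠ 0}.Nonempty := by
      have := hn (min i c) (i - min i c) (by omega) (by omega)
      rw [show min i c + (i - min i c) = i by omega] at this
      exact ⟨_, this⟩
    have hbdd := (finite_setOf_betti_ne_zero (F.tensor F') i).bddAbove
    exact ⟨_, Nat.sSup_mem hne hbdd, fun j hj => le_csSup hbdd hj⟩
  choose! m'' hm'' using hex
  refine ⟨c + c', e * e', m'', hc.tensor hc',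
    he.tensor hI hI' (ne_top_of_hasCodim hc) (ne_top_of_hasCodim hc') he',
    fun i hi => hm'' i (Finset.mem_Icc.1 hi).2, ?_⟩
  have key := choose_mul_prod_le_prod n n' m'' c c' fun a b ha hb =>
    (hm'' (a + b) (by omega)).2 (hn a b ha hb)
  have e1 : ∏ i ∈ Finset.Icc 1 c, n i = ∏ i ∈ Finset.Icc 1 c, m i :=
    Finset.prod_congr rfl fun i hi => if_neg (by have := Finset.mem_Icc.1 hi; omega)
  have e2 : ∏ i ∈ Finset.Icc 1 c', n' i = ∏ i ∈ Finset.Icc 1 c', m' i :=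
    Finset.prod_congr rfl fun i hi => if_neg (by have := Finset.mem_Icc.1 hi; omega)
  rw [e1, e2] at key
  have key' : ((c + c').choose c : ℚ) *
      ((∏ i ∈ Finset.Icc 1 c, (m i : ℚ)) * ∏ i ∈ Finset.Icc 1 c', (m' i : ℚ)) ≤
      (∏ i ∈ Finset.Icc 1 (c + c'), (m'' i : ℚ)) := by
    exact_mod_cast key
  have hf : ((c + c').choose c : ℚ) * (c ! : ℚ) * (c' ! : ℚ) = ((c + c')! : ℚ) := by
    rw [Nat.choose_symm_add]
    exact_mod_cast Nat.add_choose_mul_factorial_mul_factorial c c'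
  calc ((e * e' : ℕ) : ℚ) = (e : ℚ) * (e' : ℚ) := by push_cast; rfl
    _ ≤ ((∏ i ∈ Finset.Icc 1 c, (m i : ℚ)) / (c ! : ℚ)) *
        ((∏ i ∈ Finset.Icc 1 c', (m' i : ℚ)) / (c' ! : ℚ)) := by gcongr
    _ = (((c + c').choose c : ℚ) * ((∏ i ∈ Finset.Icc 1 c, (m i : ℚ)) *
        ∏ i ∈ Finset.Icc 1 c', (m' i : ℚ))) / ((c + c')! : ℚ) := by
      rw [← hf]
      have h1 : ((c + c').choose c : ℚ) ≠ 0 := by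
        exact_mod_cast (Nat.choose_pos (Nat.le_add_right c c')).ne'
      have h2 : (c ! : ℚ) ≠ 0 := by exact_mod_cast c.factorial_ne_zero
      have h3 : (c' ! : ℚ) ≠ 0 := by exact_mod_cast c'.factorial_ne_zero
      field_simp
    _ ≤ _ := by gcongr

end Bounds

end MultiplicityConjecture

namespace GradedFreeComplex

/-! ### Contracting homotopies over the ground field -/

section Contraction

variable {k : Type*} [Field k] {σ : Type*} (F : GradedFreeComplex k σ)

lemma mem_term_iff {i : ℕ} {x : F.basis →₀ MvPolynomial σ k} :
    x ∈ F.term i ↔ ∀ b, F.hdeg b ≠ i → x b = 0 :=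
  Finsupp.mem_supported' _ _

lemma single_mem_term (b : F.basis) (f : MvPolynomial σ k) :
    Finsupp.single b f ∈ F.term (F.hdeg b) :=
  Finsupp.single_mem_supported _ _ rfl

lemma diff_single (b : F.basis) (f : MvPolynomial σ k) :
    F.diff (Finsupp.single b f) = f • F.d b :=
  Finsupp.linearCombination_single _ _ _

lemma diff_diff (x : F.basis →₀ MvPolynomial σ k) : F.diff (F.diff x) = 0 := by
  induction x using Finsupp.induction_linear with
  | zero => simp
  | add x y hx hy => simp [hx, hy]
  | single b f =>
    rw [diff_single, map_smul]
    exact (congrArg (f • ·) (F.d_comp_d b)).trans (smul_zero f)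

lemma d_mem_term {b : F.basis} {i : ℕ} (hb : F.hdeg b = i + 1) : F.d b ∈ F.term i := by
  rw [mem_term_iff]
  intro a ha
  by_contra hne
  exact ha (by have := F.d_hdeg b a hne; omega)

lemma d_eq_zero {b : F.basis} (hb : F.hdeg b = 0) : F.d b = 0 := by
  ext1 a
  by_contra hne
  have := F.d_hdeg b a hne
  omega

lemma mem_term_induction {i : ℕ} {Q : (F.basis →₀ MvPolynomial σ k) → Prop} (h0 : Q 0)
    (hadd : ∀ x y, Q x → Q y → Q (x + y))
    (hsingle : ∀ b f, F.hdeg b = i → Q (Finsupp.single b f)) {x : F.basis →₀ MvPolynomial σ k}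
    (hx : x ∈ F.term i) : Q x := by
  rw [← x.sum_single]
  refine Finset.sum_induction _ Q hadd h0 fun b hb => hsingle b _ ?_
  by_contra hne
  exact Finsupp.mem_support_iff.1 hb (F.mem_term_iff.1 hx b hne)

lemma diff_mem_term {i : ℕ} {x : F.basis →₀ MvPolynomial σ k} (hx : x ∈ F.term (i + 1)) :
    F.diff x ∈ F.term i := by
  refine F.mem_term_induction (Q := fun x => F.diff x ∈ F.term i) ?_ ?_ ?_ hx
  · simp
  · intro x y hx hy
    rw [map_add]
    exact add_mem hx hy
  · intro b f hb
    rw [diff_single]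
    exact Submodule.smul_mem _ _ (F.d_mem_term hb)

lemma diff_eq_zero {x : F.basis →₀ MvPolynomial σ k} (hx : x ∈ F.term 0) : F.diff x = 0 := by
  refine F.mem_term_induction (Q := fun x => F.diff x = 0) ?_ ?_ ?_ hx
  · simp
  · intro x y hx hy
    rw [map_add, hx, hy, add_zero]
  · intro b f hb
    rw [diff_single, F.d_eq_zero hb, smul_zero]

open Classical in
/-- The `k`-linear projection of `⨁ i, F i` onto `F i`. -/
noncomputable def degProj (i : ℕ) :
    (F.basis →₀ MvPolynomial σ k) →ₗ[k] (F.basis →₀ MvPolynomial σ k) :=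
  Finsupp.lsum k fun b => if F.hdeg b = i then Finsupp.lsingle b else 0

lemma degProj_single (i : ℕ) (b : F.basis) (f : MvPolynomial σ k) :
    F.degProj i (Finsupp.single b f) = if F.hdeg b = i then Finsupp.single b f else 0 := by
  rw [degProj, Finsupp.lsum_single]
  split_ifs <;> rfl

lemma degProj_of_mem {i : ℕ} {x : F.basis →₀ MvPolynomial σ k} (hx : x ∈ F.term i) (j : ℕ) :
    F.degProj j x = if i = j then x else 0 := by
  refine F.mem_term_induction (Q := fun x => F.degProj j x = if i = j then x else 0) ?_ ?_ ?_ hx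
  · simp
  · intro x y hx hy
    rw [map_add, hx, hy]
    split_ifs <;> simp
  · intro b f hb
    rw [degProj_single, hb]

lemma degProj_mem (i : ℕ) (x : F.basis →₀ MvPolynomial σ k) : F.degProj i x ∈ F.term i := by
  induction x using Finsupp.induction_linear with
  | zero => simp
  | add x y hx hy => rw [map_add]; exact add_mem hx hy
  | single b f =>
    rw [degProj_single]
    split_ifs with h
    · exact h ▸ F.single_mem_term b f
    · exact zero_mem _

lemma diff_degProj (i : ℕ) (x : F.basis →₀ MvPolynomial σ k) :
    F.diff (F.degProj (i + 1) x) = F.degProj i (F.diff x) := by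
  induction x using Finsupp.induction_linear with
  | zero => simp
  | add x y hx hy => rw [map_add, map_add, map_add, map_add, hx, hy]
  | single b f =>
    rw [degProj_single]
    rcases hb : F.hdeg b with _ | j
    · have := F.single_mem_term b f
      rw [hb] at this
      simp [F.diff_eq_zero this]
    · have := F.single_mem_term b f
      rw [hb] at this
      rw [F.degProj_of_mem (F.diff_mem_term this)]
      simp only [Nat.add_right_cancel_iff]
      split_ifs <;> simp

/-- Every endomorphism of a vector space has a generalized inverse. -/
lemma exists_linearMap_apply_apply_apply_eq {V : Type*} [AddCommGroup V] [Module k V]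
    (d : V →ₗ[k] V) : ∃ g : V →ₗ[k] V, ∀ x, d (g (d x)) = d x := by
  obtain ⟨s, hs⟩ := d.rangeRestrict.exists_rightInverse_of_surjective d.range_rangeRestrict
  obtain ⟨g, hg⟩ := s.exists_extend
  refine ⟨g, fun x => ?_⟩
  have h1 : g (d x) = s (d.rangeRestrict x) := LinearMap.congr_fun hg (d.rangeRestrict x)
  rw [h1]
  exact congrArg Subtype.val (LinearMap.congr_fun hs (d.rangeRestrict x))

/-- A complex of vector spaces has a generalized inverse of its differential that raises the
homological degree by one. -/
lemma exists_generalizedInverse :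
    ∃ g : (F.basis →₀ MvPolynomial σ k) →ₗ[k] (F.basis →₀ MvPolynomial σ k),
      (∀ i, ∀ x ∈ F.term i, g x ∈ F.term (i + 1)) ∧ ∀ x, F.diff (g (F.diff x)) = F.diff x := by
  let d : (F.basis →₀ MvPolynomial σ k) →ₗ[k] (F.basis →₀ MvPolynomial σ k) :=
    F.diff.restrictScalars k
  obtain ⟨g₀, hdg⟩ : ∃ g₀ : (F.basis →₀ MvPolynomial σ k) →ₗ[k] (F.basis →₀ MvPolynomial σ k),
    ∀ x, F.diff (g₀ (F.diff x)) = F.diff x := exists_linearMap_apply_apply_apply_eq d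
  -- the component of degree one of `g₀` is still a generalized inverse
  let g : (F.basis →₀ MvPolynomial σ k) →ₗ[k] (F.basis →₀ MvPolynomial σ k) :=
    Finsupp.lsum k fun b => F.degProj (F.hdeg b + 1) ∘ₗ g₀ ∘ₗ Finsupp.lsingle b
  have hg : ∀ i, ∀ x ∈ F.term i, g x = F.degProj (i + 1) (g₀ x) := by
    intro i x hx
    refine F.mem_term_induction (Q := fun x => g x = F.degProj (i + 1) (g₀ x)) ?_ ?_ ?_ hx
    · simp
    · intro x y hx hy
      rw [map_add, map_add, map_add, hx, hy]
    · rintro b f rfl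
      simp [g]
  refine ⟨g, fun i x hx => by rw [hg i x hx]; exact F.degProj_mem _ _, fun x => ?_⟩
  induction x using Finsupp.induction_linear with
  | zero => simp
  | add x y hx hy => rw [map_add, map_add, map_add, hx, hy]
  | single b f =>
    have hmem := F.single_mem_term b f
    rcases hb : F.hdeg b with _ | j
    · rw [hb] at hmem
      simp [F.diff_eq_zero hmem]
    · rw [hb] at hmem
      have hd := F.diff_mem_term hmem
      rw [hg j _ hd, diff_degProj, hdg, F.degProj_of_mem hd, if_pos rfl]

/-- Let `d * d = 0` and `d * g * d = d`.  The homotopy `h = (1 - d * g) * (g * d * g)` satisfies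
`d * h * d = d` and `h * h = 0`, so that `1 - d * h - h * d` is idempotent and annihilates `d`. -/
lemma homotopy_projection {R : Type*} [Ring R] (d g : R) (dd : d * d = 0)
    (dgd : d * (g * d) = d) :
    let h := (1 - d * g) * (g * (d * g))
    let p := 1 - d * h - h * d
    p * d = 0 ∧ d * p = 0 ∧ p * p = p := by
  intro h p
  have dd' : ∀ x, d * (d * x) = 0 := fun x => by rw [← mul_assoc, dd, zero_mul]
  have dgd' : ∀ x, d * (g * (d * x)) = d * x := fun x => by
    rw [← mul_assoc g, ← mul_assoc d, dgd]
  have dh : d * h = d * g := by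
    simp only [h, mul_sub, sub_mul, one_mul, mul_assoc, dd', dgd', sub_zero]
  have dhd : d * (h * d) = d := by rw [← mul_assoc, dh, mul_assoc, dgd]
  have hh : h * h = 0 := by
    simp only [h, mul_sub, sub_mul, one_mul, mul_assoc, dgd', sub_self]
  have hh' : ∀ x, h * (h * x) = 0 := fun x => by rw [← mul_assoc, hh, zero_mul]
  have pd : p * d = 0 := by
    simp only [p, sub_mul, one_mul, mul_assoc, dd, dhd, mul_zero, sub_self]
  have dp : d * p = 0 := by
    simp only [p, mul_sub, mul_one, dd', dhd, sub_zero, sub_self]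
  refine ⟨pd, dp, ?_⟩
  have : p * p = p * (1 - d * h - h * d) := rfl
  rw [this, mul_sub, mul_sub, ← mul_assoc p d, pd, zero_mul, mul_one, sub_zero, sub_eq_self]
  simp only [p, sub_mul, one_mul, mul_assoc, hh', dhd, mul_zero, sub_zero, sub_self]

/-- Exactness in positive degrees, as in the definition of a resolution. -/
def IsExactInPositiveDegrees : Prop :=
  ∀ i, ∀ x ∈ F.term (i + 1), F.diff x = 0 → ∃ y ∈ F.term (i + 2), F.diff y = x

/-- A complex of `k`-vector spaces that is exact in positive degrees has a contracting homotopy `h`: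
`d h + h d = 1 - p`, with a projection `p` that lives in degree `0` only. -/
lemma IsExactInPositiveDegrees.exists_homotopy {F : GradedFreeComplex k σ}
    (hF : F.IsExactInPositiveDegrees) :
    ∃ h p : (F.basis →₀ MvPolynomial σ k) →ₗ[k] (F.basis →₀ MvPolynomial σ k),
      (∀ i, ∀ x ∈ F.term i, h x ∈ F.term (i + 1)) ∧ (∀ i, ∀ x ∈ F.term i, p x ∈ F.term i) ∧
      (∀ i, ∀ x ∈ F.term (i + 1), p x = 0) ∧
      (∀ x, F.diff (h x) + h (F.diff x) + p x = x) ∧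
      (∀ x, p (F.diff x) = 0) ∧ ∀ x, F.diff (p x) = 0 := by
  obtain ⟨g, hgmem, hg⟩ := F.exists_generalizedInverse
  let d : Module.End k (F.basis →₀ MvPolynomial σ k) := F.diff.restrictScalars k
  let G : Module.End k (F.basis →₀ MvPolynomial σ k) := g
  have dd : d * d = 0 := LinearMap.ext F.diff_diff
  have dGd : d * (G * d) = d := LinearMap.ext hg
  let h : Module.End k (F.basis →₀ MvPolynomial σ k) := (1 - d * G) * (G * (d * G))
  let p : Module.End k (F.basis →₀ MvPolynomial σ k) := 1 - d * h - h * d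
  obtain ⟨pd, dp, pp⟩ : p * d = 0 ∧ d * p = 0 ∧ p * p = p :=
    homotopy_projection d G dd dGd
  have hdmem : ∀ i, ∀ x ∈ F.term i, d (G x) ∈ F.term i := fun i x hx =>
    F.diff_mem_term (hgmem i x hx)
  have hhmem : ∀ i, ∀ x ∈ F.term i, h x ∈ F.term (i + 1) := fun i x hx => by
    have h1 : G (d (G x)) ∈ F.term (i + 1) := hgmem i _ (hdmem i x hx)
    exact sub_mem h1 (hdmem _ _ h1)
  have hpmem : ∀ i, ∀ x ∈ F.term i, p x ∈ F.term i := fun i x hx => by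
    refine sub_mem (sub_mem hx (F.diff_mem_term (hhmem i x hx))) ?_
    rcases i with _ | i
    · have : d x = 0 := F.diff_eq_zero hx
      rw [Module.End.mul_apply, this, map_zero]
      exact zero_mem _
    · exact hhmem i _ (F.diff_mem_term hx)
  refine ⟨h, p, hhmem, hpmem, fun i x hx => ?_, fun x => ?_, fun x => LinearMap.congr_fun pd x,
    fun x => LinearMap.congr_fun dp x⟩
  · obtain ⟨y, -, hy⟩ := hF i (p x) (hpmem _ x hx) (LinearMap.congr_fun dp x)
    calc p x = p (p x) := (LinearMap.congr_fun pp x).symm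
      _ = p (d y) := by rw [← hy]; rfl
      _ = 0 := LinearMap.congr_fun pd y
  · change d (h x) + h (d x) + (x - d (h x) - h (d x)) = x
    abel

end Contraction

/-! ### Exactness of the tensor product of resolutions -/

section Tensor

open MultiplicityConjecture

variable {k : Type*} [Field k] {σ τ : Type*} (F : GradedFreeComplex k σ)
  (F' : GradedFreeComplex k τ)

/-- The canonical isomorphism `S^(ι) ⊗_k S'^(ι') ≃ S''^(ι × ι')`. -/
noncomputable def finsuppTensorEquiv (k σ τ ι ι' : Type*) [Field k] :
    ((ι →₀ MvPolynomial σ k) ⊗[k] (ι' →₀ MvPolynomial τ k)) ≃ₗ[k]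
      (ι × ι' →₀ MvPolynomial (σ ⊕ τ) k) :=
  finsuppTensorFinsupp k k (MvPolynomial σ k) (MvPolynomial τ k) ι ι' ≪≫ₗ
    Finsupp.mapRange.linearEquiv (polyTensorEquiv k σ τ).toLinearEquiv

section

variable {ι ι' : Type*}

lemma finsuppTensorEquiv_single (b : ι) (f : MvPolynomial σ k) (b' : ι') (f' : MvPolynomial τ k) :
    finsuppTensorEquiv k σ τ ι ι' (Finsupp.single b f ⊗ₜ Finsupp.single b' f') =
      Finsupp.single (b, b') (rename Sum.inl f * rename Sum.inr f') := by
  rw [finsuppTensorEquiv, LinearEquiv.trans_apply, finsuppTensorFinsupp_single,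
    Finsupp.mapRange.linearEquiv_apply, Finsupp.mapRange_single]
  exact congrArg _ (polyTensorEquiv_tmul f f')

lemma finsuppTensorEquiv_apply (x : ι →₀ MvPolynomial σ k) (y : ι' →₀ MvPolynomial τ k)
    (b : ι) (b' : ι') :
    finsuppTensorEquiv k σ τ ι ι' (x ⊗ₜ y) (b, b') =
      rename Sum.inl (x b) * rename Sum.inr (y b') := by
  rw [finsuppTensorEquiv, LinearEquiv.trans_apply, Finsupp.mapRange.linearEquiv_apply,
    Finsupp.mapRange_apply, finsuppTensorFinsupp_apply]
  exact polyTensorEquiv_tmul _ _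

lemma finsuppTensorEquiv_smul_single (f : MvPolynomial σ k) (x : ι →₀ MvPolynomial σ k)
    (b' : ι') (f' : MvPolynomial τ k) :
    finsuppTensorEquiv k σ τ ι ι' ((f • x) ⊗ₜ Finsupp.single b' f') =
      (rename Sum.inl f * rename Sum.inr f' : MvPolynomial (σ ⊕ τ) k) •
        x.sum fun a g => Finsupp.single (a, b') (rename Sum.inl g) := by
  conv_lhs => rw [← x.sum_single]
  rw [Finsupp.smul_sum, Finsupp.sum, Finsupp.sum, TensorProduct.sum_tmul, map_sum,
    Finset.smul_sum]
  refine Finset.sum_congr rfl fun a _ => ?_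
  rw [Finsupp.smul_single, finsuppTensorEquiv_single, Finsupp.smul_single, smul_eq_mul,
    smul_eq_mul, map_mul]
  congr 1
  ring

lemma finsuppTensorEquiv_single_smul (f' : MvPolynomial τ k) (y : ι' →₀ MvPolynomial τ k)
    (b : ι) (f : MvPolynomial σ k) :
    finsuppTensorEquiv k σ τ ι ι' (Finsupp.single b f ⊗ₜ (f' • y)) =
      (rename Sum.inl f * rename Sum.inr f' : MvPolynomial (σ ⊕ τ) k) •
        y.sum fun a g => Finsupp.single (b, a) (rename Sum.inr g) := by
  conv_lhs => rw [← y.sum_single]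
  rw [Finsupp.smul_sum, Finsupp.sum, Finsupp.sum, TensorProduct.tmul_sum, map_sum,
    Finset.smul_sum]
  refine Finset.sum_congr rfl fun a _ => ?_
  rw [Finsupp.smul_single, finsuppTensorEquiv_single, Finsupp.smul_single, smul_eq_mul,
    smul_eq_mul, map_mul]
  congr 1
  ring

end

/-- The `k`-linear identification of the tensor product over `k` of the modules underlying `F` and
`F'` with the module underlying `F.tensor F'`. -/
noncomputable def tensorEquiv :
    ((F.basis →₀ MvPolynomial σ k) ⊗[k] (F'.basis →₀ MvPolynomial τ k)) ≃ₗ[k]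
      ((F.tensor F').basis →₀ MvPolynomial (σ ⊕ τ) k) :=
  finsuppTensorEquiv k σ τ F.basis F'.basis

/-- The basis element `b ⊗ b'` of `F.tensor F'`. -/
def tensorBasis (b : F.basis) (b' : F'.basis) : (F.tensor F').basis := (b, b')

lemma tensorEquiv_single (b : F.basis) (f : MvPolynomial σ k) (b' : F'.basis)
    (f' : MvPolynomial τ k) :
    F.tensorEquiv F' (Finsupp.single b f ⊗ₜ Finsupp.single b' f') =
      Finsupp.single (F.tensorBasis F' b b') (rename Sum.inl f * rename Sum.inr f') :=
  finsuppTensorEquiv_single b f b' f'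

lemma tensorEquiv_apply (x : F.basis →₀ MvPolynomial σ k) (y : F'.basis →₀ MvPolynomial τ k)
    (b : F.basis) (b' : F'.basis) :
    F.tensorEquiv F' (x ⊗ₜ y) (F.tensorBasis F' b b') =
      rename Sum.inl (x b) * rename Sum.inr (y b') :=
  finsuppTensorEquiv_apply x y b b'

lemma tensorEquiv_mem_term {i j : ℕ} {x : F.basis →₀ MvPolynomial σ k}
    {y : F'.basis →₀ MvPolynomial τ k} (hx : x ∈ F.term i) (hy : y ∈ F'.term j) :
    F.tensorEquiv F' (x ⊗ₜ y) ∈ (F.tensor F').term (i + j) := by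
  rw [mem_term_iff]
  rintro ⟨b, b'⟩ hb
  have hb' : F.hdeg b + F'.hdeg b' ≠ i + j := hb
  refine (tensorEquiv_apply F F' x y b b').trans ?_
  by_cases h : F.hdeg b = i
  · rw [F'.mem_term_iff.1 hy b' (by omega), map_zero, mul_zero]
  · rw [F.mem_term_iff.1 hx b h, map_zero, zero_mul]

lemma diff_tensorEquiv {i : ℕ} {x : F.basis →₀ MvPolynomial σ k} (hx : x ∈ F.term i)
    (y : F'.basis →₀ MvPolynomial τ k) :
    (F.tensor F').diff (F.tensorEquiv F' (x ⊗ₜ y)) =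
      F.tensorEquiv F' (F.diff x ⊗ₜ y) + (-1 : k) ^ i • F.tensorEquiv F' (x ⊗ₜ F'.diff y) := by
  refine F.mem_term_induction (Q := fun x => (F.tensor F').diff (F.tensorEquiv F' (x ⊗ₜ y)) =
      F.tensorEquiv F' (F.diff x ⊗ₜ y) + (-1 : k) ^ i • F.tensorEquiv F' (x ⊗ₜ F'.diff y))
    ?_ ?_ ?_ hx
  · simp
  · intro x x' h h'
    simp only [TensorProduct.add_tmul, map_add, h, h', smul_add]
    abel
  rintro b f rfl
  induction y using Finsupp.induction_linear with
  | zero => simp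
  | add y y' h h' =>
    simp only [TensorProduct.tmul_add, map_add, h, h', smul_add]
    abel
  | single b' f' =>
    have key : Finsupp.linearCombination (MvPolynomial (σ ⊕ τ) k) (F.tensorD F')
        (finsuppTensorEquiv k σ τ F.basis F'.basis (Finsupp.single b f ⊗ₜ Finsupp.single b' f')) =
        finsuppTensorEquiv k σ τ F.basis F'.basis ((f • F.d b) ⊗ₜ Finsupp.single b' f') +
        (-1 : k) ^ F.hdeg b • finsuppTensorEquiv k σ τ F.basis F'.basis
          (Finsupp.single b f ⊗ₜ (f' • F'.d b')) := by
      rw [finsuppTensorEquiv_single, finsuppTensorEquiv_smul_single,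
        finsuppTensorEquiv_single_smul, Finsupp.linearCombination_single, tensorD, smul_add,
        ← algebraMap_smul (MvPolynomial (σ ⊕ τ) k) ((-1 : k) ^ F.hdeg b),
        smul_comm _ ((-1 : MvPolynomial (σ ⊕ τ) k) ^ _), map_pow, map_neg, map_one]
    rw [diff_single, diff_single]
    exact key

/-- A `k`-subspace of `⨁ i, (F ⊗ F') i` contains the term of degree `n` if it contains the elements
`f b ⊗ f' b'` for all basis elements `b`, `b'` whose degrees add up to `n`. -/
lemma tensor_term_le {n : ℕ} (Q : Submodule k ((F.tensor F').basis →₀ MvPolynomial (σ ⊕ τ) k))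
    (h : ∀ b f b' f', F.hdeg b + F'.hdeg b' = n →
      F.tensorEquiv F' (Finsupp.single b f ⊗ₜ Finsupp.single b' f') ∈ Q)
    {x : (F.tensor F').basis →₀ MvPolynomial (σ ⊕ τ) k} (hx : x ∈ (F.tensor F').term n) :
    x ∈ Q := by
  refine (F.tensor F').mem_term_induction (Q := (· ∈ Q)) Q.zero_mem (fun x y => Q.add_mem) ?_ hx
  intro c f hb
  obtain ⟨b, b', rfl⟩ : ∃ b b', c = F.tensorBasis F' b b' := ⟨c.1, c.2, rfl⟩
  obtain ⟨t, rfl⟩ := (polyTensorEquiv k σ τ).surjective f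
  induction t with
  | zero =>
    rw [map_zero, Finsupp.single_zero]
    exact Q.zero_mem
  | add t u ht hu =>
    rw [map_add, Finsupp.single_add]
    exact Q.add_mem ht hu
  | tmul f f' =>
    rw [polyTensorEquiv_tmul, ← tensorEquiv_single]
    exact h b f b' f' hb

lemma tensor_isExactInPositiveDegrees (hF : F.IsExactInPositiveDegrees)
    (hF' : F'.IsExactInPositiveDegrees) : (F.tensor F').IsExactInPositiveDegrees := by
  obtain ⟨h, p, hmem, pmem, ppos, hp, pd, dp⟩ := hF.exists_homotopy
  obtain ⟨h', p', hmem', pmem', ppos', hp', pd', dp'⟩ := hF'.exists_homotopy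
  -- the homotopy `h ⊗ 1 + p ⊗ h'` contracts `F ⊗ F'` to `p ⊗ p'`
  obtain ⟨E, hE⟩ : ∃ E, E = F.tensorEquiv F' := ⟨_, rfl⟩
  obtain ⟨H, HE⟩ : ∃ H : Module.End k ((F.tensor F').basis →₀ MvPolynomial (σ ⊕ τ) k),
      ∀ x y, H (E (x ⊗ₜ y)) = E (h x ⊗ₜ y) + E (p x ⊗ₜ h' y) :=
    ⟨E.toLinearMap ∘ₗ (TensorProduct.map h LinearMap.id + TensorProduct.map p h') ∘ₗ
      E.symm.toLinearMap, fun x y => by simp⟩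
  obtain ⟨P, PE⟩ : ∃ P : Module.End k ((F.tensor F').basis →₀ MvPolynomial (σ ⊕ τ) k),
      ∀ x y, P (E (x ⊗ₜ y)) = E (p x ⊗ₜ p' y) :=
    ⟨E.toLinearMap ∘ₗ TensorProduct.map p p' ∘ₗ E.symm.toLinearMap, fun x y => by simp⟩
  obtain ⟨D, hD⟩ : ∃ D : Module.End k ((F.tensor F').basis →₀ MvPolynomial (σ ⊕ τ) k),
      ∀ z, D z = (F.tensor F').diff z := ⟨(F.tensor F').diff.restrictScalars k, fun _ => rfl⟩
  have DE : ∀ i, ∀ x ∈ F.term i, ∀ y, D (E (x ⊗ₜ y)) =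
      E (F.diff x ⊗ₜ y) + (-1 : k) ^ i • E (x ⊗ₜ F'.diff y) := fun i x hx y => by
    rw [hD, hE]
    exact F.diff_tensorEquiv F' hx y
  have key₀ : ∀ i, ∀ x ∈ F.term i, ∀ y,
      D (H (E (x ⊗ₜ y))) + H (D (E (x ⊗ₜ y))) + P (E (x ⊗ₜ y)) = E (x ⊗ₜ y) := by
    intro i x hx y
    have sgn : ∀ w, (-1 : k) ^ i • E (p x ⊗ₜ w) = E (p x ⊗ₜ w) := fun w => by
      rcases i with _ | i
      · rw [pow_zero, one_smul]
      · rw [ppos i x hx, TensorProduct.zero_tmul, map_zero, smul_zero]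
    have e1 : E (x ⊗ₜ y) = E (F.diff (h x) ⊗ₜ y) + E (h (F.diff x) ⊗ₜ y) + E (p x ⊗ₜ y) := by
      rw [← map_add, ← map_add, ← TensorProduct.add_tmul, ← TensorProduct.add_tmul, hp]
    have e2 : E (p x ⊗ₜ y) = E (p x ⊗ₜ F'.diff (h' y)) + E (p x ⊗ₜ h' (F'.diff y)) +
        E (p x ⊗ₜ p' y) := by
      rw [← map_add, ← map_add, ← TensorProduct.tmul_add, ← TensorProduct.tmul_add, hp']
    rw [DE i x hx, PE, HE, map_add, map_add, map_smul, HE, HE, DE _ _ (hmem i x hx),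
      DE _ _ (pmem i x hx), dp, pd, TensorProduct.zero_tmul, map_zero,
      smul_add, sgn, sgn, e1, e2, pow_succ, mul_neg_one, neg_smul]
    abel
  have key : ∀ z, D (H z) + H (D z) + P z = z := by
    intro z
    obtain ⟨t, rfl⟩ := E.surjective z
    have hadd : ∀ t u, D (H (E t)) + H (D (E t)) + P (E t) = E t →
        D (H (E u)) + H (D (E u)) + P (E u) = E u →
        D (H (E (t + u))) + H (D (E (t + u))) + P (E (t + u)) = E (t + u) := fun t u ht hu => by
      have h3 : D (H (E (t + u))) + H (D (E (t + u))) + P (E (t + u)) =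
          D (H (E t)) + H (D (E t)) + P (E t) + (D (H (E u)) + H (D (E u)) + P (E u)) := by
        simp only [map_add]
        abel
      rw [h3, ht, hu, map_add]
    have hzero : D (H (E 0)) + H (D (E 0)) + P (E 0) = E 0 := by simp only [map_zero, add_zero]
    induction t with
    | zero => exact hzero
    | add t u ht hu => exact hadd t u ht hu
    | tmul x y =>
      induction x using Finsupp.induction_linear with
      | zero => rw [TensorProduct.zero_tmul]; exact hzero
      | add x x' hx hx' => rw [TensorProduct.add_tmul]; exact hadd _ _ hx hx'
      | single b f => exact key₀ _ _ (F.single_mem_term b f) y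
  intro i z hz hdz
  refine ⟨H z, ?_, ?_⟩
  · refine F.tensor_term_le F' (((F.tensor F').term (i + 2)).restrictScalars k |>.comap H) ?_ hz
    intro b f b' f' hb
    change H _ ∈ (F.tensor F').term (i + 2)
    rw [← hE, HE, hE]
    have h1 := F.tensorEquiv_mem_term F' (hmem _ _ (F.single_mem_term b f))
      (F'.single_mem_term b' f')
    have h2 := F.tensorEquiv_mem_term F' (pmem _ _ (F.single_mem_term b f))
      (hmem' _ _ (F'.single_mem_term b' f'))
    rw [show F.hdeg b + 1 + F'.hdeg b' = i + 2 by omega] at h1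
    rw [show F.hdeg b + (F'.hdeg b' + 1) = i + 2 by omega] at h2
    exact add_mem h1 h2
  · have hP : P z = 0 := by
      refine F.tensor_term_le F' (LinearMap.ker P) ?_ hz
      intro b f b' f' hb
      rw [LinearMap.mem_ker, ← hE, PE]
      have hb1 := F.single_mem_term b f
      have hb2 := F'.single_mem_term b' f'
      rcases hbi : F.hdeg b with _ | m
      · have hbi' : F'.hdeg b' = i + 1 := by omega
        rw [hbi'] at hb2
        rw [ppos' _ _ hb2, TensorProduct.tmul_zero, map_zero]
      · rw [hbi] at hb1
        rw [ppos _ _ hb1, TensorProduct.zero_tmul, map_zero]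
    have hz' := key z
    rw [hP, add_zero, hD z, hdz, map_zero, add_zero, hD] at hz'
    exact hz'

/-- The tensor product of graded free resolutions of `S/I` and `S'/I'` is a graded free resolution
of `(S/I) ⊗_k (S'/I')`. -/
lemma IsResolution.tensor {F : GradedFreeComplex k σ} {F' : GradedFreeComplex k τ}
    {I : Ideal (MvPolynomial σ k)} {I' : Ideal (MvPolynomial τ k)} (hF : F.IsResolution I)
    (hF' : F'.IsResolution I') : (F.tensor F').IsResolution (tensorIdeal I I') := by
  refine ⟨?_, F.tensor_isExactInPositiveDegrees F' hF.2 hF'.2⟩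
  obtain ⟨b₀, hb, hdeg, hI⟩ := hF.1
  obtain ⟨b₀', hb', hdeg', hI'⟩ := hF'.1
  have hiff : ∀ b, F.hdeg b = 0 ↔ b = b₀ := fun b => by simpa using Set.ext_iff.1 hb b
  have hiff' : ∀ b, F'.hdeg b = 0 ↔ b = b₀' := fun b => by simpa using Set.ext_iff.1 hb' b
  refine ⟨F.tensorBasis F' b₀ b₀', ?_, ?_, fun f => ⟨fun hf => ?_, ?_⟩⟩
  · ext ⟨b, b'⟩
    change F.hdeg b + F'.hdeg b' = 0 ↔ (b, b') = (b₀, b₀')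
    rw [Nat.add_eq_zero_iff, hiff, hiff', Prod.mk.injEq]
  · change F.deg b₀ + F'.deg b₀' = 0
    rw [hdeg, hdeg']
  · -- the ideal of all `f` with `f (b₀ ⊗ b₀')` in the image of the differential
    let J : Ideal (MvPolynomial (σ ⊕ τ) k) :=
      (((F.tensor F').term 1).map (F.tensor F').diff).comap
        (Finsupp.lsingle (F.tensorBasis F' b₀ b₀'))
    have hle : tensorIdeal I I' ≤ J := by
      refine sup_le (Ideal.map_le_iff_le_comap.2 fun g hg => ?_)
        (Ideal.map_le_iff_le_comap.2 fun g hg => ?_)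
      · obtain ⟨x, hx, hxg⟩ := (hI g).1 hg
        have h1 := F'.single_mem_term b₀' 1
        rw [(hiff' b₀').2 rfl] at h1
        refine ⟨F.tensorEquiv F' (x ⊗ₜ Finsupp.single b₀' 1),
          F.tensorEquiv_mem_term F' hx h1, ?_⟩
        rw [F.diff_tensorEquiv F' hx, hxg, F'.diff_eq_zero h1, tensorEquiv_single]
        simp
      · obtain ⟨x, hx, hxg⟩ := (hI' g).1 hg
        have h1 := F.single_mem_term b₀ 1
        rw [(hiff b₀).2 rfl] at h1
        have h2 := F.tensorEquiv_mem_term F' h1 hx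
        rw [zero_add] at h2
        refine ⟨F.tensorEquiv F' (Finsupp.single b₀ 1 ⊗ₜ x), h2, ?_⟩
        rw [F.diff_tensorEquiv F' h1, hxg, F.diff_eq_zero h1, tensorEquiv_single]
        simp
    obtain ⟨x, hx, hxf⟩ := hle hf
    exact ⟨x, hx, hxf⟩
  · rintro ⟨x, hx, hxf⟩
    -- an element of degree `0` is a multiple of the basis element
    have hsupp : ∀ w ∈ F.term 0, w = Finsupp.single b₀ (w b₀) := fun w hw => by
      ext1 b
      by_cases hbb : b = b₀
      · rw [hbb, Finsupp.single_eq_same]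
      · rw [Finsupp.single_eq_of_ne hbb, F.mem_term_iff.1 hw b (mt (hiff b).1 hbb)]
    have hsupp' : ∀ w ∈ F'.term 0, w = Finsupp.single b₀' (w b₀') := fun w hw => by
      ext1 b
      by_cases hbb : b = b₀'
      · rw [hbb, Finsupp.single_eq_same]
      · rw [Finsupp.single_eq_of_ne hbb, F'.mem_term_iff.1 hw b (mt (hiff' b).1 hbb)]
    let Q : Submodule k ((F.tensor F').basis →₀ MvPolynomial (σ ⊕ τ) k) :=
      (((tensorIdeal I I').restrictScalars k).comap
        (Finsupp.lapply (F.tensorBasis F' b₀ b₀'))).comap ((F.tensor F').diff.restrictScalars k)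
    have hxQ : x ∈ Q := by
      refine F.tensor_term_le F' Q ?_ hx
      intro b g b' g' hbb
      change (F.tensor F').diff (F.tensorEquiv F' _) (F.tensorBasis F' b₀ b₀') ∈ tensorIdeal I I'
      have hb1 := F.single_mem_term b g
      have hb2 := F'.single_mem_term b' g'
      rw [F.diff_tensorEquiv F' hb1]
      rcases hbi : F.hdeg b with _ | m
      · have hbi' : F'.hdeg b' = 0 + 1 := by omega
        rw [hbi] at hb1
        rw [hbi'] at hb2
        rw [F.diff_eq_zero hb1, TensorProduct.zero_tmul, map_zero, zero_add, pow_zero, one_smul,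
          tensorEquiv_apply]
        exact Ideal.mul_mem_left _ _ (rename_inr_mem_tensorIdeal I
          ((hI' _).2 ⟨_, hb2, hsupp' _ (F'.diff_mem_term hb2)⟩))
      · have hbi' : F'.hdeg b' = 0 := by omega
        obtain rfl : m = 0 := by omega
        rw [hbi] at hb1
        rw [hbi'] at hb2
        rw [F'.diff_eq_zero hb2, TensorProduct.tmul_zero, map_zero, smul_zero, add_zero,
          tensorEquiv_apply]
        exact Ideal.mul_mem_right _ _ (rename_inl_mem_tensorIdeal I'
          ((hI _).2 ⟨_, hb1, hsupp _ (F.diff_mem_term hb1)⟩))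
    have : (F.tensor F').diff x (F.tensorBasis F' b₀ b₀') ∈ tensorIdeal I I' := hxQ
    rw [hxf] at this
    simpa using this

end Tensor

end GradedFreeComplex

namespace MultiplicityConjecture

/-! ### Regular sequences and Rees' theorem -/

section RegularSequences

open CategoryTheory Abelian Limits RingTheory.Sequence

universe u

variable {R : Type u} [CommRing R]

/-- `f` is a nonzerodivisor modulo `J`. -/
def IsRegularElementMod (J : Ideal R) (f : R) : Prop :=
  ∀ x, f * x ∈ J → x ∈ J

/-- The list `fs` is a weakly regular sequence modulo `J`: each element is a nonzerodivisor modulo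
`J` and its predecessors. -/
def IsRegularMod : Ideal R → List R → Prop
  | _, [] => True
  | J, f :: fs => IsRegularElementMod J f ∧ IsRegularMod (J ⊔ Ideal.span {f}) fs

lemma isSMulRegular_quotient_iff (J : Ideal R) (f : R) :
    IsSMulRegular (R ⧸ J) f ↔ IsRegularElementMod J f :=
  isSMulRegular_quotient_iff_mem_of_smul_mem J f

/-- `(R/J)/f(R/J) ≃ R/(J + fR)`. -/
noncomputable def quotSMulTopEquiv (J : Ideal R) (f : R) :
    QuotSMulTop f (R ⧸ J) ≃ₗ[R] R ⧸ (J ⊔ Ideal.span {f}) :=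
  (Submodule.quotEquivOfEq _ _ (by
    rw [← Submodule.range_mkQ J, ← Submodule.map_top, ← Submodule.map_pointwise_smul,
      ← Submodule.ideal_span_singleton_smul, smul_eq_mul, Ideal.mul_top])).trans
    (Submodule.quotientQuotientEquivQuotientSup J (Ideal.span {f}))

lemma isWeaklyRegular_quotient_iff (J : Ideal R) (fs : List R) :
    IsWeaklyRegular (R ⧸ J) fs ↔ IsRegularMod J fs := by
  induction fs generalizing J with
  | nil => simp [IsRegularMod]
  | cons f fs ih =>
    rw [isWeaklyRegular_cons_iff, isSMulRegular_quotient_iff,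
      (quotSMulTopEquiv J f).isWeaklyRegular_congr, ih, IsRegularMod]

lemma isRegularMod_append_iff (J : Ideal R) (fs gs : List R) :
    IsRegularMod J (fs ++ gs) ↔ IsRegularMod J fs ∧ IsRegularMod (J ⊔ Ideal.ofList fs) gs := by
  induction fs generalizing J with
  | nil => simp [IsRegularMod]
  | cons f fs ih =>
    rw [List.cons_append, IsRegularMod, ih, IsRegularMod, Ideal.ofList_cons, and_assoc, sup_assoc]

lemma smul_top_quotient_lt_top {J m : Ideal R} (hJ : J ≤ m) (hm : m ≠ ⊤) :
    m • (⊤ : Submodule R (R ⧸ J)) < ⊤ := by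
  refine lt_top_iff_ne_top.2 fun h => hm ?_
  have h1 : m • (⊤ : Submodule R (R ⧸ J)) = Submodule.map (Submodule.mkQ J) m := by
    rw [← Submodule.range_mkQ J, ← Submodule.map_top, ← Submodule.map_smul'', smul_eq_mul,
      Ideal.mul_top]
  rw [h1] at h
  have h2 := congrArg (Submodule.comap (Submodule.mkQ J)) h
  rwa [Submodule.comap_map_mkQ, Submodule.comap_top, sup_eq_right.2 hJ] at h2

lemma isRegular_quotient_iff {J m : Ideal R} (hJ : J ≤ m) (hm : m ≠ ⊤) {fs : List R}
    (hfs : ∀ f ∈ fs, f ∈ m) : IsRegular (R ⧸ J) fs ↔ IsRegularMod J fs := by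
  rw [isRegular_iff, isWeaklyRegular_quotient_iff, and_iff_left]
  refine ((Submodule.smul_mono_left ?_).trans_lt (smul_top_quotient_lt_top hJ hm)).ne'
  exact Ideal.span_le.2 hfs

/-- If there is a regular sequence of length `n + 1` in `m` modulo `J`, then after dividing out any
nonzerodivisor of `m` there is still one of length `n`: the vanishing of `Ext^i(R/m, R/J)` for
`i ≤ n` gives that of `Ext^i(R/m, R/(J + fR))` for `i < n`. -/
lemma exists_isRegularMod_sup_span [IsNoetherianRing R] {J m : Ideal R} (hJ : J ≤ m) (hm : m ≠ ⊤)
    {rs : List R} (hrs : ∀ r ∈ rs, r ∈ m) (hreg : IsRegularMod J rs) {n : ℕ}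
    (hn : rs.length = n + 1) {f : R} (hf : f ∈ m) (hfreg : IsRegularElementMod J f) :
    ∃ ss : List R, ss.length = n ∧ (∀ s ∈ ss, s ∈ m) ∧
      IsRegularMod (J ⊔ Ideal.span {f}) ss := by
  have hJf : J ⊔ Ideal.span {f} ≤ m := sup_le hJ ((Ideal.span_singleton_le_iff_mem _).2 hf)
  let N : ModuleCat.{u} R := ModuleCat.of R (R ⧸ m)
  have suppN : Module.support R N = PrimeSpectrum.zeroLocus m := by
    rw [Module.support_eq_zeroLocus, Ideal.annihilator_quotient]
  have : Module.Finite R N := inferInstanceAs (Module.Finite R (R ⧸ m))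
  have h_ext := ModuleCat.subsingleton_ext_of_exists_isRegular m N suppN.subset
    (ModuleCat.of R (R ⧸ J)) (smul_top_quotient_lt_top hJ hm) rs hrs
    ((isRegular_quotient_iff hJ hm hrs).2 hreg)
  have hx : IsSMulRegular (ModuleCat.of R (R ⧸ J)) f := (isSMulRegular_quotient_iff J f).2 hfreg
  have h_ext' : ∀ i < n,
      Subsingleton (Ext N (ModuleCat.of R (QuotSMulTop f (R ⧸ J))) i) := by
    intro i hi
    have zero1 := AddCommGrpCat.isZero_of_iff_subsingleton.mpr (h_ext i (by omega))
    have zero2 := AddCommGrpCat.isZero_of_iff_subsingleton.mpr (h_ext (i + 1) (by omega))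
    exact AddCommGrpCat.subsingleton_of_isZero <| ShortComplex.Exact.isZero_of_both_zeros
      ((Ext.covariant_sequence_exact₃' N hx.smulShortComplex_shortExact) i (i + 1) rfl)
      (zero1.eq_zero_of_src _) (zero2.eq_zero_of_tgt _)
  have e := (quotSMulTopEquiv J f).toModuleIso
  have h_ext'' : ∀ i < n,
      Subsingleton (Ext N (ModuleCat.of R (R ⧸ (J ⊔ Ideal.span {f}))) i) := by
    intro i hi
    have := h_ext' i hi
    refine ⟨fun a b => ?_⟩
    have key : ∀ c : Ext N (ModuleCat.of R (R ⧸ (J ⊔ Ideal.span {f}))) i,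
        c = (c.comp (Ext.mk₀ e.inv) (add_zero i)).comp (Ext.mk₀ e.hom) (add_zero i) := by
      intro c
      simp
    rw [key a, key b, Subsingleton.elim (a.comp (Ext.mk₀ e.inv) (add_zero i))
      (b.comp (Ext.mk₀ e.inv) (add_zero i))]
  obtain ⟨ss, h1, h2, h3⟩ := ModuleCat.exists_isRegular_of_exists_subsingleton_ext m n
    (ModuleCat.of R (R ⧸ (J ⊔ Ideal.span {f}))) (smul_top_quotient_lt_top hJf hm) N suppN h_ext''
  exact ⟨ss, h1, h2, (isRegular_quotient_iff hJf hm h2).1 h3⟩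

/-- A regular sequence that is shorter than some other regular sequence can be prolonged. -/
lemma exists_isRegularElementMod_of_length_lt [IsNoetherianRing R] {J m : Ideal R} (hJ : J ≤ m)
    (hm : m ≠ ⊤) {rs zs : List R} (hrs : ∀ r ∈ rs, r ∈ m) (hreg : IsRegularMod J rs)
    (hzs : ∀ z ∈ zs, z ∈ m) (hzreg : IsRegularMod J zs) (hlt : zs.length < rs.length) :
    ∃ f ∈ m, IsRegularElementMod (J ⊔ Ideal.ofList zs) f := by
  induction zs generalizing J rs with
  | nil =>
    obtain ⟨r, rs, rfl⟩ := List.exists_cons_of_length_pos hlt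
    exact ⟨r, hrs r (by simp), by simpa using hreg.1⟩
  | cons z zs ih =>
    obtain ⟨n, hn⟩ : ∃ n, rs.length = n + 1 := ⟨rs.length - 1, by simp at hlt; omega⟩
    have hz : z ∈ m := hzs z (by simp)
    obtain ⟨ss, h1, h2, h3⟩ := exists_isRegularMod_sup_span hJ hm hrs hreg hn hz hzreg.1
    obtain ⟨f, hf, hf'⟩ := ih (sup_le hJ ((Ideal.span_singleton_le_iff_mem _).2 hz)) h2 h3
      (fun y hy => hzs y (by simp [hy])) hzreg.2 (by simp at hlt; omega)
    exact ⟨f, hf, by rwa [Ideal.ofList_cons, ← sup_assoc]⟩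

/-- `a` represents a nonzero element of the socle of `R/J` with respect to `m`. -/
def IsSocleElement (m J : Ideal R) (a : R) : Prop :=
  a ∉ J ∧ ∀ f ∈ m, f * a ∈ J

lemma IsSocleElement.not_isRegularElementMod {m J : Ideal R} {a : R} (ha : IsSocleElement m J a)
    {f : R} (hf : f ∈ m) : ¬ IsRegularElementMod J f :=
  fun h => ha.1 (h a (ha.2 f hf))

/-- If a maximal ideal consists of zerodivisors modulo `J`, then by prime avoidance it is an
associated prime of `R/J`. -/
lemma exists_isSocleElement [IsNoetherianRing R] {J m : Ideal R} [hmax : m.IsMaximal]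
    (h : ∀ f ∈ m, ¬ IsRegularElementMod J f) : ∃ a, IsSocleElement m J a := by
  have hsub : (m : Set R) ⊆ ⋃ p ∈ associatedPrimes R (R ⧸ J), (p : Set R) := by
    rw [biUnion_associatedPrimes_eq_compl_regular]
    intro f hf
    simpa [isSMulRegular_quotient_iff] using h f hf
  have hfin := associatedPrimes.finite R (R ⧸ J)
  obtain ⟨p, hp, hmp⟩ := (Ideal.subset_union_prime_finite hfin (f := id) ⊥ ⊥
    (fun p hp _ _ => hp.isPrime)).1 hsub
  have hpm : m = p := hmax.eq_of_le hp.isPrime.ne_top hmp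
  obtain ⟨-, x, hx⟩ := (isAssociatedPrime_iff).1 hp
  obtain ⟨a, rfl⟩ := Ideal.Quotient.mk_surjective x
  have hmem : ∀ f, f ∈ m ↔ f * a ∈ J := by
    intro f
    rw [hpm, hx, Submodule.mem_colon_singleton, Submodule.mem_bot, ← Ideal.Quotient.eq_zero_iff_mem]
    rfl
  refine ⟨a, fun ha => hmax.ne_top ((Ideal.eq_top_iff_one _).2 ((hmem 1).2 (by simpa using ha))),
    fun f hf => (hmem f).1 hf⟩

end RegularSequences

/-! ### Maximal regular sequences and socles -/

section MaximalRegularSequences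

open RingTheory.Sequence

variable {R : Type*} [CommRing R]

lemma ringKrullDim_quotient_sup_span_add_one_le {J : Ideal R} {f : R}
    (hf : IsRegularElementMod J f) :
    ringKrullDim (R ⧸ (J ⊔ Ideal.span {f})) + 1 ≤ ringKrullDim (R ⧸ J) := by
  have hreg : Ideal.Quotient.mk J f ∈ nonZeroDivisors (R ⧸ J) := by
    rw [mem_nonZeroDivisors_iff_right]
    intro x hx
    obtain ⟨x, rfl⟩ := Ideal.Quotient.mk_surjective x
    rw [← map_mul, Ideal.Quotient.eq_zero_iff_mem, mul_comm] at hx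
    exact Ideal.Quotient.eq_zero_iff_mem.2 (hf x hx)
  have h := ringKrullDim_quotient_succ_le_of_nonZeroDivisor hreg
  have e := DoubleQuot.quotQuotEquivQuotSup J (Ideal.span {f})
  rw [Ideal.map_span, Set.image_singleton] at e
  rwa [ringKrullDim_eq_of_ringEquiv e] at h

lemma ringKrullDim_quotient_sup_ofList_add_length_le {J : Ideal R} {fs : List R}
    (hf : IsRegularMod J fs) :
    ringKrullDim (R ⧸ (J ⊔ Ideal.ofList fs)) + (fs.length : WithBot ℕ∞) ≤
      ringKrullDim (R ⧸ J) := by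
  induction fs generalizing J with
  | nil =>
    have h : J ⊔ Ideal.ofList [] = J := by simp
    rw [h]
    simp
  | cons f fs ih =>
    have h1 := ringKrullDim_quotient_sup_span_add_one_le hf.1
    have h2 := ih hf.2
    rw [Ideal.ofList_cons, ← sup_assoc, List.length_cons, Nat.cast_add, Nat.cast_one, ← add_assoc]
    exact (add_le_add_left h2 1).trans h1

lemma sup_ofList_le {J m : Ideal R} (hJ : J ≤ m) {fs : List R} (hfs : ∀ f ∈ fs, f ∈ m) :
    J ⊔ Ideal.ofList fs ≤ m :=
  sup_le hJ (Ideal.span_le.2 hfs)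

lemma length_le_of_isRegularMod {J m : Ideal R} (hJ : J ≤ m) (hm : m ≠ ⊤) {fs : List R}
    (hfs : ∀ f ∈ fs, f ∈ m) (hreg : IsRegularMod J fs) {D : ℕ}
    (hD : ringKrullDim (R ⧸ J) = (D : WithBot ℕ∞)) : fs.length ≤ D := by
  have h := ringKrullDim_quotient_sup_ofList_add_length_le hreg
  have : Nontrivial (R ⧸ (J ⊔ Ideal.ofList fs)) :=
    Ideal.Quotient.nontrivial_iff.2 (ne_top_of_le_ne_top hm (sup_ofList_le hJ hfs))
  have h0 : (0 : WithBot ℕ∞) ≤ ringKrullDim (R ⧸ (J ⊔ Ideal.ofList fs)) :=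
    ringKrullDim_nonneg_of_nontrivial
  rw [hD] at h
  have h1 : (0 : WithBot ℕ∞) + (fs.length : WithBot ℕ∞) ≤ D := (add_le_add_left h0 _).trans h
  rw [zero_add] at h1
  exact_mod_cast h1

/-- Regular sequences in a maximal ideal can be prolonged until the quotient has a nonzero socle
element. -/
lemma exists_isRegularMod_isSocleElement [IsNoetherianRing R] {J m : Ideal R} [hmax : m.IsMaximal]
    (hJ : J ≤ m) {D : ℕ} (hD : ringKrullDim (R ⧸ J) = (D : WithBot ℕ∞)) :
    ∃ fs : List R, (∀ f ∈ fs, f ∈ m) ∧ IsRegularMod J fs ∧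
      ∃ a, IsSocleElement m (J ⊔ Ideal.ofList fs) a := by
  by_contra! hcon
  have key : ∀ n : ℕ, ∃ fs : List R, fs.length = n ∧ (∀ f ∈ fs, f ∈ m) ∧ IsRegularMod J fs := by
    intro n
    induction n with
    | zero => exact ⟨[], by simp [IsRegularMod]⟩
    | succ n ih =>
      obtain ⟨fs, h1, h2, h3⟩ := ih
      obtain ⟨f, hf, hf'⟩ : ∃ f ∈ m, IsRegularElementMod (J ⊔ Ideal.ofList fs) f := by
        by_contra! hno
        obtain ⟨a, ha⟩ := exists_isSocleElement hno
        exact hcon fs h2 h3 a ha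
      refine ⟨fs ++ [f], by simp [h1], ?_, ?_⟩
      · intro g hg
        rcases List.mem_append.1 hg with hg | hg
        · exact h2 g hg
        · rwa [List.mem_singleton.1 hg]
      · exact (isRegularMod_append_iff _ _ _).2 ⟨h3, hf', trivial⟩
  obtain ⟨fs, h1, h2, h3⟩ := key (D + 1)
  have := length_le_of_isRegularMod hJ hmax.ne_top h2 h3 hD
  omega

end MaximalRegularSequences

/-! ### Cohen-Macaulay tensor products -/

section CohenMacaulay

variable {k : Type*} [Field k] {σ τ : Type*}

lemma mem_idealOfVars_iff (p : MvPolynomial σ k) : p ∈ idealOfVars σ k ↔ constantCoeff p = 0 := by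
  rw [← pow_one (idealOfVars σ k), mem_pow_idealOfVars_iff']
  simp [Finsupp.degree_eq_zero_iff, constantCoeff_eq]

instance idealOfVars_isMaximal : (idealOfVars σ k).IsMaximal := by
  have h : idealOfVars σ k = RingHom.ker (constantCoeff : MvPolynomial σ k →+* k) :=
    Ideal.ext fun p => mem_idealOfVars_iff p
  rw [h]
  exact RingHom.ker_isMaximal_of_surjective _ fun c => ⟨C c, constantCoeff_C _ _⟩

lemma le_idealOfVars {I : Ideal (MvPolynomial σ k)}
    (hI : I.IsHomogeneous (homogeneousSubmodule σ k)) (hI1 : I ≠ ⊤) : I ≤ idealOfVars σ k := by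
  intro f hf
  rw [mem_idealOfVars_iff]
  by_contra hne
  have h := homogeneousComponent_mem hI hf 0
  rw [homogeneousComponent_zero] at h
  refine hI1 (Ideal.eq_top_of_isUnit_mem _ h ?_)
  exact (IsUnit.mk0 (coeff 0 f) (by simpa [constantCoeff_eq] using hne)).map C

/-- Nonzerodivisors on `S/I` remain nonzerodivisors on `(S/I) ⊗_k (S'/I')`, as `S'/I'` is flat over
the field `k`. -/
lemma IsRegularElementMod.rename_inl {I : Ideal (MvPolynomial σ k)} {f : MvPolynomial σ k}
    (hf : IsRegularElementMod I f) (I' : Ideal (MvPolynomial τ k)) :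
    IsRegularElementMod (tensorIdeal I I') (rename Sum.inl f) := by
  intro x hx
  obtain ⟨y, hy⟩ := (quotTensorEquiv I I').surjective (Ideal.Quotient.mk _ x)
  have hinj : Function.Injective (LinearMap.mulLeft k (Ideal.Quotient.mk I f)) := by
    rw [injective_iff_map_eq_zero]
    intro z hz
    obtain ⟨z, rfl⟩ := Ideal.Quotient.mk_surjective z
    rw [LinearMap.mulLeft_apply, ← map_mul, Ideal.Quotient.eq_zero_iff_mem] at hz
    exact Ideal.Quotient.eq_zero_iff_mem.2 (hf z hz)
  have hinj' := Module.Flat.rTensor_preserves_injective_linearMap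
    (M := MvPolynomial τ k ⧸ I') _ hinj
  have hmul : (LinearMap.mulLeft k (Ideal.Quotient.mk I f)).rTensor (MvPolynomial τ k ⧸ I') =
      LinearMap.mulLeft k (Ideal.Quotient.mk I f ⊗ₜ[k] (1 : MvPolynomial τ k ⧸ I')) :=
    TensorProduct.ext' fun a b => by simp
  have h0 : (Ideal.Quotient.mk I f ⊗ₜ[k] (1 : MvPolynomial τ k ⧸ I')) * y = 0 := by
    apply (quotTensorEquiv I I').injective
    rw [map_mul, hy, map_zero, ← map_one (Ideal.Quotient.mk I'), quotTensorEquiv_tmul, map_one,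
      mul_one, ← map_mul]
    exact Ideal.Quotient.eq_zero_iff_mem.2 hx
  rw [hmul] at hinj'
  have hy0 : y = 0 := hinj' (h0.trans (map_zero _).symm)
  rw [hy0, map_zero] at hy
  exact Ideal.Quotient.eq_zero_iff_mem.1 hy.symm

lemma map_rename_swap_tensorIdeal (I : Ideal (MvPolynomial σ k)) (I' : Ideal (MvPolynomial τ k)) :
    (tensorIdeal I I').map (rename (R := k) Sum.swap) = tensorIdeal I' I := by
  have h1 : (rename (R := k) (Sum.swap : σ ⊕ τ → τ ⊕ σ)).toRingHom.comp
      (rename (R := k) Sum.inl).toRingHom = (rename (R := k) Sum.inr).toRingHom := by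
    ext <;> simp
  have h2 : (rename (R := k) (Sum.swap : σ ⊕ τ → τ ⊕ σ)).toRingHom.comp
      (rename (R := k) Sum.inr).toRingHom = (rename (R := k) Sum.inl).toRingHom := by
    ext <;> simp
  rw [tensorIdeal, tensorIdeal, Ideal.map_sup, sup_comm]
  congr 1
  · have := Ideal.map_map (I := I') (rename (R := k) (Sum.inr : τ → σ ⊕ τ)).toRingHom
      (rename (R := k) (Sum.swap : σ ⊕ τ → τ ⊕ σ)).toRingHom
    rw [h2] at this
    exact this
  · have := Ideal.map_map (I := I) (rename (R := k) (Sum.inl : σ → σ ⊕ τ)).toRingHom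
      (rename (R := k) (Sum.swap : σ ⊕ τ → τ ⊕ σ)).toRingHom
    rw [h1] at this
    exact this

lemma rename_swap_mem_tensorIdeal {I : Ideal (MvPolynomial σ k)} {I' : Ideal (MvPolynomial τ k)}
    {p : MvPolynomial (σ ⊕ τ) k} (hp : p ∈ tensorIdeal I I') :
    rename Sum.swap p ∈ tensorIdeal I' I := by
  rw [← map_rename_swap_tensorIdeal]
  exact Ideal.mem_map_of_mem _ hp

lemma IsRegularElementMod.rename_inr {I' : Ideal (MvPolynomial τ k)} {f : MvPolynomial τ k}
    (hf : IsRegularElementMod I' f) (I : Ideal (MvPolynomial σ k)) :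
    IsRegularElementMod (tensorIdeal I I') (rename Sum.inr f) := by
  intro x hx
  have h1 := rename_swap_mem_tensorIdeal hx
  rw [map_mul, rename_rename, show Sum.swap ∘ Sum.inr = (Sum.inl : τ → τ ⊕ σ) from rfl] at h1
  have h2 := rename_swap_mem_tensorIdeal (hf.rename_inl I _ h1)
  rwa [rename_rename, Sum.swap_swap_eq, rename_id_apply] at h2

lemma tensorIdeal_sup_span_left (I : Ideal (MvPolynomial σ k)) (I' : Ideal (MvPolynomial τ k))
    (f : MvPolynomial σ k) :
    tensorIdeal (I ⊔ Ideal.span {f}) I' = tensorIdeal I I' ⊔ Ideal.span {rename Sum.inl f} := by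
  rw [tensorIdeal, tensorIdeal, Ideal.map_sup, Ideal.map_span, Set.image_singleton, sup_right_comm]

lemma tensorIdeal_sup_span_right (I : Ideal (MvPolynomial σ k)) (I' : Ideal (MvPolynomial τ k))
    (f : MvPolynomial τ k) :
    tensorIdeal I (I' ⊔ Ideal.span {f}) = tensorIdeal I I' ⊔ Ideal.span {rename Sum.inr f} := by
  rw [tensorIdeal, tensorIdeal, Ideal.map_sup, Ideal.map_span, Set.image_singleton, sup_assoc]

lemma tensorIdeal_sup_ofList_left (I : Ideal (MvPolynomial σ k)) (I' : Ideal (MvPolynomial τ k))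
    (fs : List (MvPolynomial σ k)) : tensorIdeal (I ⊔ Ideal.ofList fs) I' =
      tensorIdeal I I' ⊔ Ideal.ofList (fs.map (rename Sum.inl)) := by
  induction fs generalizing I with
  | nil => simp
  | cons f fs ih =>
    rw [Ideal.ofList_cons, ← sup_assoc, ih, tensorIdeal_sup_span_left, List.map_cons,
      Ideal.ofList_cons, sup_assoc]

lemma tensorIdeal_sup_ofList_right (I : Ideal (MvPolynomial σ k)) (I' : Ideal (MvPolynomial τ k))
    (fs : List (MvPolynomial τ k)) : tensorIdeal I (I' ⊔ Ideal.ofList fs) =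
      tensorIdeal I I' ⊔ Ideal.ofList (fs.map (rename Sum.inr)) := by
  induction fs generalizing I' with
  | nil => simp
  | cons f fs ih =>
    rw [Ideal.ofList_cons, ← sup_assoc, ih, tensorIdeal_sup_span_right, List.map_cons,
      Ideal.ofList_cons, sup_assoc]

lemma IsRegularMod.rename_inl {I : Ideal (MvPolynomial σ k)} {fs : List (MvPolynomial σ k)}
    (hf : IsRegularMod I fs) (I' : Ideal (MvPolynomial τ k)) :
    IsRegularMod (tensorIdeal I I') (fs.map (rename Sum.inl)) := by
  induction fs generalizing I with
  | nil => trivial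
  | cons f fs ih => exact ⟨hf.1.rename_inl I', tensorIdeal_sup_span_left I I' f ▸ ih hf.2⟩

lemma IsRegularMod.rename_inr {I' : Ideal (MvPolynomial τ k)} {fs : List (MvPolynomial τ k)}
    (hf : IsRegularMod I' fs) (I : Ideal (MvPolynomial σ k)) :
    IsRegularMod (tensorIdeal I I') (fs.map (rename Sum.inr)) := by
  induction fs generalizing I' with
  | nil => trivial
  | cons f fs ih => exact ⟨hf.1.rename_inr I, tensorIdeal_sup_span_right I I' f ▸ ih hf.2⟩

/-- The product of two socle elements is a socle element of the tensor product. -/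
lemma IsSocleElement.rename_mul_rename {I : Ideal (MvPolynomial σ k)}
    {I' : Ideal (MvPolynomial τ k)} {a : MvPolynomial σ k} {b : MvPolynomial τ k}
    (ha : IsSocleElement (idealOfVars σ k) I a) (hb : IsSocleElement (idealOfVars τ k) I' b) :
    IsSocleElement (idealOfVars (σ ⊕ τ) k) (tensorIdeal I I')
      (rename Sum.inl a * rename Sum.inr b) := by
  refine ⟨?_, ?_⟩
  · rw [rename_mul_rename_mem_tensorIdeal_iff]
    exact not_or.2 ⟨ha.1, hb.1⟩
  · have hle : idealOfVars (σ ⊕ τ) k ≤ Submodule.comap (LinearMap.mulRight (MvPolynomial (σ ⊕ τ) k)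
        (rename Sum.inl a * rename Sum.inr b)) (tensorIdeal I I') := by
      refine Ideal.span_le.2 ?_
      rintro _ ⟨i | j, rfl⟩
      · have h := rename_inl_mem_tensorIdeal I' (ha.2 (X i) (Ideal.subset_span ⟨i, rfl⟩))
        have := Ideal.mul_mem_right (rename Sum.inr b) _ h
        simpa [mul_assoc] using this
      · have h := rename_inr_mem_tensorIdeal I (hb.2 (X j) (Ideal.subset_span ⟨j, rfl⟩))
        have := Ideal.mul_mem_left _ (rename Sum.inl a) h
        simpa [mul_left_comm, mul_assoc] using this
    exact fun f hf => hle hf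

/-- If `(S/I) ⊗_k (S'/I')` is Cohen-Macaulay, then so are `S/I` and `S'/I'`.  Maximal regular
sequences on the factors combine to a regular sequence on the tensor product after which there is
a socle element, so that it cannot be prolonged; hence its length is the depth. -/
lemma IsCohenMacaulay.of_tensor [Finite σ] [Finite τ] {I : Ideal (MvPolynomial σ k)}
    {I' : Ideal (MvPolynomial τ k)}
    (hI : I.IsHomogeneous (homogeneousSubmodule σ k))
    (hI' : I'.IsHomogeneous (homogeneousSubmodule τ k)) {D D' : ℕ}
    (hD : ringKrullDim (MvPolynomial σ k ⧸ I) = (D : WithBot ℕ∞))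
    (hD' : ringKrullDim (MvPolynomial τ k ⧸ I') = (D' : WithBot ℕ∞))
    (h : IsCohenMacaulay (tensorIdeal I I')) : IsCohenMacaulay I ∧ IsCohenMacaulay I' := by
  have hI1 : I ≠ ⊤ := by
    rintro rfl
    rw [ringKrullDim_eq_bot_of_subsingleton] at hD
    exact WithBot.bot_ne_coe hD
  have hI1' : I' ≠ ⊤ := by
    rintro rfl
    rw [ringKrullDim_eq_bot_of_subsingleton] at hD'
    exact WithBot.bot_ne_coe hD'
  have hm : (idealOfVars σ k) ≠ ⊤ := Ideal.IsMaximal.ne_top inferInstance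
  have hm' : (idealOfVars τ k) ≠ ⊤ := Ideal.IsMaximal.ne_top inferInstance
  have hm'' : (idealOfVars (σ ⊕ τ) k) ≠ ⊤ := Ideal.IsMaximal.ne_top inferInstance
  have hle := le_idealOfVars hI hI1
  have hle' := le_idealOfVars hI' hI1'
  have hle'' := le_idealOfVars (tensorIdeal_isHomogeneous I I' hI hI')
    (tensorIdeal_ne_top I I' hI1 hI1')
  obtain ⟨xs, hxs, hxreg, a, ha⟩ := exists_isRegularMod_isSocleElement hle hD
  obtain ⟨ys, hys, hyreg, b, hb⟩ := exists_isRegularMod_isSocleElement hle' hD'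
  obtain ⟨rs, hrs, hreg, hlen⟩ := h
  rw [isRegular_quotient_iff hle'' hm'' hrs] at hreg
  rw [ringKrullDim_tensorIdeal hI1 hI1', hD, hD'] at hlen
  have hlen' : rs.length = D + D' := by exact_mod_cast hlen.symm
  set zs := xs.map (rename Sum.inl) ++ ys.map (rename (R := k) (Sum.inr : τ → σ ⊕ τ)) with hzs_def
  have hz : tensorIdeal I I' ⊔ Ideal.ofList zs =
      tensorIdeal (I ⊔ Ideal.ofList xs) (I' ⊔ Ideal.ofList ys) := by
    rw [tensorIdeal_sup_ofList_right, tensorIdeal_sup_ofList_left, hzs_def, Ideal.ofList_append,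
      sup_assoc]
  have hzs : ∀ z ∈ zs, z ∈ idealOfVars (σ ⊕ τ) k := by
    intro z hz
    rw [hzs_def, List.mem_append, List.mem_map, List.mem_map] at hz
    rcases hz with ⟨x, hx, rfl⟩ | ⟨y, hy, rfl⟩
    · rw [mem_idealOfVars_iff, constantCoeff_rename, ← mem_idealOfVars_iff]
      exact hxs x hx
    · rw [mem_idealOfVars_iff, constantCoeff_rename, ← mem_idealOfVars_iff]
      exact hys y hy
  have hzreg : IsRegularMod (tensorIdeal I I') zs := by
    rw [hzs_def, isRegularMod_append_iff]
    refine ⟨hxreg.rename_inl I', ?_⟩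
    rw [← tensorIdeal_sup_ofList_left]
    exact hyreg.rename_inr _
  have hxlen := length_le_of_isRegularMod hle hm hxs hxreg hD
  have hylen := length_le_of_isRegularMod hle' hm' hys hyreg hD'
  have hge : rs.length ≤ zs.length := by
    by_contra! hlt
    obtain ⟨f, hf, hfreg⟩ :=
      exists_isRegularElementMod_of_length_lt hle'' hm'' hrs hreg hzs hzreg hlt
    rw [hz] at hfreg
    exact (ha.rename_mul_rename hb).not_isRegularElementMod hf hfreg
  have hzlen : zs.length = xs.length + ys.length := by simp [hzs_def]
  refine ⟨⟨xs, hxs, (isRegular_quotient_iff hle hm hxs).2 hxreg, ?_⟩,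
    ⟨ys, hys, (isRegular_quotient_iff hle' hm' hys).2 hyreg, ?_⟩⟩
  · rw [hD]; congr 1; omega
  · rw [hD']; congr 1; omega

lemma SatisfiesConjecture.tensor [Finite σ] [Finite τ] {I : Ideal (MvPolynomial σ k)}
    {I' : Ideal (MvPolynomial τ k)} {F : GradedFreeComplex k σ} {F' : GradedFreeComplex k τ}
    (hI : I.IsHomogeneous (homogeneousSubmodule σ k))
    (hI' : I'.IsHomogeneous (homogeneousSubmodule τ k)) (h0 : StartsInDegreeZero F)
    (h0' : StartsInDegreeZero F') (h : SatisfiesConjecture F I) (h' : SatisfiesConjecture F' I') :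
    SatisfiesConjecture (F.tensor F') (tensorIdeal I I') := by
  refine ⟨h.1.tensor hI hI' h0 h0' h'.1, fun hCM => ?_⟩
  obtain ⟨-, -, -, -, ⟨D, hD, -⟩, -⟩ := h.1
  obtain ⟨-, -, -, -, ⟨D', hD', -⟩, -⟩ := h'.1
  obtain ⟨h1, h2⟩ := hCM.of_tensor hI hI' hD hD'
  exact (h.2 h1).tensor hI hI' h0 h0' (h'.2 h2)

end CohenMacaulay

end MultiplicityConjecture

/-! ### Minimal complexes -/

lemma GradedFreeComplex.IsMinimal.tensor {k : Type*} [Field k] {σ τ : Type*}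
    {F : GradedFreeComplex k σ} {F' : GradedFreeComplex k τ} (hF : F.IsMinimal)
    (hF' : F'.IsMinimal) : (F.tensor F').IsMinimal := by
  intro p q
  change constantCoeff (F.tensorD F' p q) = 0
  by_cases h : F.tensorD F' p q = 0
  · rw [h, map_zero]
  rcases F.tensorD_ne_zero F' p q h with ⟨h1, h2⟩ | ⟨h1, h2⟩
  · have hne : q.1 ≠ p.1 := fun he => by
      have := F.d_hdeg _ _ h1
      rw [he] at this
      omega
    rw [F.tensorD_apply_of_ne F' p q h2 hne, constantCoeff_rename, hF]
  · have hne : q.2 ≠ p.2 := fun he => by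
      have := F'.d_hdeg _ _ h1
      rw [he] at this
      omega
    rw [F.tensorD_apply_of_ne' F' p q h2 hne, map_mul, constantCoeff_rename, hF', mul_zero]

namespace MultiplicityConjecture

/-! ### Monomial ideals and Taylor resolutions -/

section MonomialIdeals

variable {k : Type*} [Field k] {σ τ : Type*}

lemma IsMonomialIdeal.tensorIdeal {I : Ideal (MvPolynomial σ k)} {I' : Ideal (MvPolynomial τ k)}
    (h : IsMonomialIdeal I) (h' : IsMonomialIdeal I') : IsMonomialIdeal (tensorIdeal I I') := by
  obtain ⟨A, rfl⟩ := h
  obtain ⟨A', rfl⟩ := h'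
  refine ⟨Finsupp.mapDomain Sum.inl '' A ∪ Finsupp.mapDomain Sum.inr '' A', ?_⟩
  rw [MultiplicityConjecture.tensorIdeal, Ideal.map_span, Ideal.map_span, ← Ideal.span_union,
    Set.image_union]
  congr 2 <;> simp only [Set.image_image, rename_monomial]

lemma sumElim_le_sumElim_iff {s s' : σ →₀ ℕ} {t t' : τ →₀ ℕ} :
    s.sumElim t ≤ s'.sumElim t' ↔ s ≤ s' ∧ t ≤ t' := by
  simp [Finsupp.le_def]

lemma exists_eq_sumElim (u : σ ⊕ τ →₀ ℕ) : ∃ (s : σ →₀ ℕ) (t : τ →₀ ℕ), u = s.sumElim t := by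
  obtain ⟨s, t, h⟩ := exists_eq_mapDomain_inl_add_mapDomain_inr u
  exact ⟨s, t, by rw [h, Finsupp.sumElim_eq_add]⟩

lemma monomial_sumElim_mem_tensorIdeal_iff (I : Ideal (MvPolynomial σ k))
    (I' : Ideal (MvPolynomial τ k)) (s : σ →₀ ℕ) (t : τ →₀ ℕ) :
    monomial (s.sumElim t) (1 : k) ∈ tensorIdeal I I' ↔
      monomial s (1 : k) ∈ I ∨ monomial t (1 : k) ∈ I' := by
  rw [← rename_mul_rename_mem_tensorIdeal_iff, rename_monomial, rename_monomial, monomial_mul,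
    one_mul, Finsupp.sumElim_eq_add]

lemma monomial_zero_notMem {I : Ideal (MvPolynomial σ k)} (hI : I ≠ ⊤) :
    monomial 0 (1 : k) ∉ I := fun h => hI ((Ideal.eq_top_iff_one _).2 h)

/-- The minimal generators of `I S'' + I' S''` are those of `I` together with those of `I'`. -/
lemma sumElim_mem_gens_tensorIdeal_iff {I : Ideal (MvPolynomial σ k)}
    {I' : Ideal (MvPolynomial τ k)} (hI : I ≠ ⊤) (hI' : I' ≠ ⊤) (s : σ →₀ ℕ) (t : τ →₀ ℕ) :
    s.sumElim t ∈ gens (tensorIdeal I I') ↔ (s ∈ gens I ∧ t = 0) ∨ (s = 0 ∧ t ∈ gens I') := by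
  have h0 := monomial_zero_notMem hI
  have h0' := monomial_zero_notMem hI'
  constructor
  · rintro ⟨hmem, hmin⟩
    rcases (monomial_sumElim_mem_tensorIdeal_iff I I' s t).1 hmem with h | h
    · refine Or.inl ⟨⟨h, fun s' hs' hle => ?_⟩, ?_⟩
      · exact (sumElim_le_sumElim_iff.1 (hmin
          ((monomial_sumElim_mem_tensorIdeal_iff I I' s' t).2 (Or.inl hs'))
          (sumElim_le_sumElim_iff.2 ⟨hle, le_rfl⟩))).1
      · exact le_bot_iff.1 (sumElim_le_sumElim_iff.1 (hmin
          ((monomial_sumElim_mem_tensorIdeal_iff I I' s 0).2 (Or.inl h))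
          (sumElim_le_sumElim_iff.2 ⟨le_rfl, bot_le⟩))).2
    · refine Or.inr ⟨?_, ⟨h, fun t' ht' hle => ?_⟩⟩
      · exact le_bot_iff.1 (sumElim_le_sumElim_iff.1 (hmin
          ((monomial_sumElim_mem_tensorIdeal_iff I I' 0 t).2 (Or.inr h))
          (sumElim_le_sumElim_iff.2 ⟨bot_le, le_rfl⟩))).1
      · exact (sumElim_le_sumElim_iff.1 (hmin
          ((monomial_sumElim_mem_tensorIdeal_iff I I' s t').2 (Or.inr ht'))
          (sumElim_le_sumElim_iff.2 ⟨le_rfl, hle⟩))).2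
  · rintro (⟨⟨h, hmin⟩, rfl⟩ | ⟨rfl, h, hmin⟩)
    · refine ⟨(monomial_sumElim_mem_tensorIdeal_iff I I' s 0).2 (Or.inl h), fun u hu hle => ?_⟩
      obtain ⟨s', t', rfl⟩ := exists_eq_sumElim u
      obtain ⟨h1, h2⟩ := sumElim_le_sumElim_iff.1 hle
      obtain rfl : t' = 0 := le_bot_iff.1 h2
      have := ((monomial_sumElim_mem_tensorIdeal_iff I I' s' 0).1 hu).resolve_right h0'
      exact sumElim_le_sumElim_iff.2 ⟨hmin this h1, le_rfl⟩
    · refine ⟨(monomial_sumElim_mem_tensorIdeal_iff I I' 0 t).2 (Or.inr h), fun u hu hle => ?_⟩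
      obtain ⟨s', t', rfl⟩ := exists_eq_sumElim u
      obtain ⟨h1, h2⟩ := sumElim_le_sumElim_iff.1 hle
      obtain rfl : s' = 0 := le_bot_iff.1 h1
      have := ((monomial_sumElim_mem_tensorIdeal_iff I I' 0 t').1 hu).resolve_left h0
      exact sumElim_le_sumElim_iff.2 ⟨le_rfl, hmin this h2⟩

/-- The embedding of the exponents of monomials in the first set of variables. -/
noncomputable def expInl (σ τ : Type*) : (σ →₀ ℕ) ↪ (σ ⊕ τ →₀ ℕ) where
  toFun s := s.sumElim 0
  inj' s s' h := Finsupp.ext fun i => by simpa using DFunLike.congr_fun h (Sum.inl i)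

/-- The embedding of the exponents of monomials in the second set of variables. -/
noncomputable def expInr (σ τ : Type*) : (τ →₀ ℕ) ↪ (σ ⊕ τ →₀ ℕ) where
  toFun t := (0 : σ →₀ ℕ).sumElim t
  inj' t t' h := Finsupp.ext fun i => by simpa using DFunLike.congr_fun h (Sum.inr i)

lemma sup_map_expInl (A : Finset (σ →₀ ℕ)) :
    (A.map (expInl σ τ)).sup id = (A.sup id).sumElim 0 := by
  rw [Finset.sup_map]
  refine (Finset.apply_sup_eq_sup_comp (fun s : σ →₀ ℕ => s.sumElim (0 : τ →₀ ℕ)) ?_ ?_).symm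
  · intro s t
    ext (i | i) <;> simp
  · exact Finsupp.sumElim_zero_zero

lemma sup_map_expInr (A : Finset (τ →₀ ℕ)) :
    (A.map (expInr σ τ)).sup id = (0 : σ →₀ ℕ).sumElim (A.sup id) := by
  rw [Finset.sup_map]
  refine (Finset.apply_sup_eq_sup_comp (fun t : τ →₀ ℕ => (0 : σ →₀ ℕ).sumElim t) ?_ ?_).symm
  · intro s t
    ext (i | i) <;> simp
  · exact Finsupp.sumElim_zero_zero

lemma degree_sumElim (s : σ →₀ ℕ) (t : τ →₀ ℕ) :
    (s.sumElim t).degree = s.degree + t.degree := by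
  rw [Finsupp.sumElim_eq_add, map_add, Finsupp.degree_mapDomain, Finsupp.degree_mapDomain]

/-- The shifts of the Taylor resolution are the degrees of the least common multiples of sets of
minimal generators. -/
lemma betti_taylorResolution_ne_zero_iff [Finite σ] {I : Ideal (MvPolynomial σ k)} {i j : ℕ} :
    (taylorResolution I).betti i j ≠ 0 ↔
      ∃ A : Finset (σ →₀ ℕ), (∀ s ∈ A, s ∈ gens I) ∧ A.card = i ∧ (A.sup id).degree = j := by
  classical
  rw [betti_ne_zero_iff]
  let e := (gens_finite I).toFinset.equivFin.symm
  let g : Fin _ ↪ (σ →₀ ℕ) := e.toEmbedding.trans (Function.Embedding.subtype _)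
  have hsup : ∀ T : Finset (Fin _), (T.map g).sup id = T.sup fun j => (e j : σ →₀ ℕ) :=
    fun T => by rw [Finset.sup_map]; rfl
  have hg : ∀ s ∈ gens I, ∃ j, g j = s := fun s hs =>
    ⟨e.symm ⟨s, (gens_finite I).mem_toFinset.2 hs⟩, by simp [g]⟩
  constructor
  · rintro ⟨T, h1, h2⟩
    change Finset (Fin _) at T
    refine ⟨T.map g, ?_, (Finset.card_map _).trans h1, by rw [hsup]; exact h2⟩
    intro s hs
    obtain ⟨j, -, rfl⟩ := Finset.mem_map.1 hs
    exact (gens_finite I).mem_toFinset.1 (e j).2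
  · rintro ⟨A, hA, h1, h2⟩
    have hAg : (A.preimage g g.injective.injOn).map g = A := by
      ext s
      simp only [Finset.mem_map, Finset.mem_preimage]
      refine ⟨fun ⟨j, hj, hjs⟩ => hjs ▸ hj, fun hs => ?_⟩
      obtain ⟨j, rfl⟩ := hg s (hA s hs)
      exact ⟨j, hs, rfl⟩
    refine ⟨A.preimage g g.injective.injOn, ?_, ?_⟩
    · rw [← h1]
      conv_rhs => rw [← hAg, Finset.card_map]
      rfl
    · rw [← h2, ← hAg, hsup, hAg]
      rfl

lemma startsInDegreeZero_taylorResolution [Finite σ] (I : Ideal (MvPolynomial σ k)) :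
    StartsInDegreeZero (taylorResolution I) := by
  intro j
  rw [betti_taylorResolution_ne_zero_iff]
  constructor
  · rintro ⟨A, -, h1, rfl⟩
    rw [Finset.card_eq_zero.1 h1, Finset.sup_empty, bot_eq_zero, map_zero]
  · rintro rfl
    exact ⟨∅, by simp, Finset.card_empty, by rw [Finset.sup_empty, bot_eq_zero, map_zero]⟩

/-- The Taylor resolution of `I S'' + I' S''` has the same shifts as the tensor product of the
Taylor resolutions of `I` and `I'`.  The ideals have to be proper: otherwise the exponent `0` may be
a generator of both, or make generators of the other ideal redundant. -/
lemma betti_taylorResolution_tensorIdeal_ne_zero_iff [Finite σ] [Finite τ]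
    {I : Ideal (MvPolynomial σ k)} {I' : Ideal (MvPolynomial τ k)} (hI : I ≠ ⊤) (hI' : I' ≠ ⊤)
    (i j : ℕ) :
    ((taylorResolution I).tensor (taylorResolution I')).betti i j ≠ 0 ↔
      (taylorResolution (tensorIdeal I I')).betti i j ≠ 0 := by
  classical
  have h0 : (0 : σ →₀ ℕ) ∉ gens I := fun h => monomial_zero_notMem hI h.1
  have h0' : (0 : τ →₀ ℕ) ∉ gens I' := fun h => monomial_zero_notMem hI' h.1
  have hl : ∀ s, expInl σ τ s ∈ gens (tensorIdeal I I') ↔ s ∈ gens I := fun s =>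
    (sumElim_mem_gens_tensorIdeal_iff hI hI' s 0).trans (by tauto)
  have hr : ∀ t, expInr σ τ t ∈ gens (tensorIdeal I I') ↔ t ∈ gens I' := fun t =>
    (sumElim_mem_gens_tensorIdeal_iff hI hI' 0 t).trans (by tauto)
  have hlr : ∀ u ∈ gens (tensorIdeal I I'),
      (∃ s, expInl σ τ s = u) ∨ ∃ t, expInr σ τ t = u := by
    intro u hu
    obtain ⟨s, t, rfl⟩ := exists_eq_sumElim u
    rcases (sumElim_mem_gens_tensorIdeal_iff hI hI' s t).1 hu with ⟨-, rfl⟩ | ⟨rfl, -⟩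
    · exact Or.inl ⟨s, rfl⟩
    · exact Or.inr ⟨t, rfl⟩
  have hunion : ∀ (A : Finset (σ →₀ ℕ)) (A' : Finset (τ →₀ ℕ)), (∀ s ∈ A, s ∈ gens I) →
      (A.map (expInl σ τ) ∪ A'.map (expInr σ τ)).card = A.card + A'.card ∧
      ((A.map (expInl σ τ) ∪ A'.map (expInr σ τ)).sup id).degree =
        (A.sup id).degree + (A'.sup id).degree := by
    intro A A' hA
    constructor
    · rw [Finset.card_union_of_disjoint, Finset.card_map, Finset.card_map]
      refine Finset.disjoint_left.2 fun u hu hu' => ?_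
      obtain ⟨s, hs, rfl⟩ := Finset.mem_map.1 hu
      obtain ⟨t, -, ht⟩ := Finset.mem_map.1 hu'
      have hs0 : s = 0 := Finsupp.ext fun x => (DFunLike.congr_fun ht (Sum.inl x)).symm
      exact h0 (hs0 ▸ hA s hs)
    · rw [Finset.sup_union, sup_map_expInl, sup_map_expInr, ← degree_sumElim]
      congr 1
      ext (x | x) <;> simp
  rw [betti_tensor_ne_zero_iff]
  simp only [betti_taylorResolution_ne_zero_iff]
  constructor
  · rintro ⟨⟨i₁, j₁⟩, ⟨i₂, j₂⟩, rfl, rfl, ⟨A, hA, rfl, rfl⟩, ⟨A', hA', rfl, rfl⟩⟩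
    refine ⟨A.map (expInl σ τ) ∪ A'.map (expInr σ τ), ?_, hunion A A' hA⟩
    intro u hu
    rcases Finset.mem_union.1 hu with hu | hu
    · obtain ⟨s, hs, rfl⟩ := Finset.mem_map.1 hu
      exact (hl s).2 (hA s hs)
    · obtain ⟨t, ht, rfl⟩ := Finset.mem_map.1 hu
      exact (hr t).2 (hA' t ht)
  · rintro ⟨B, hB, rfl, rfl⟩
    let A := B.preimage (expInl σ τ) (expInl σ τ).injective.injOn
    let A' := B.preimage (expInr σ τ) (expInr σ τ).injective.injOn
    have hA : ∀ s ∈ A, s ∈ gens I := fun s hs => (hl s).1 (hB _ (Finset.mem_preimage.1 hs))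
    have hA' : ∀ t ∈ A', t ∈ gens I' := fun t ht => (hr t).1 (hB _ (Finset.mem_preimage.1 ht))
    have hBA : A.map (expInl σ τ) ∪ A'.map (expInr σ τ) = B := by
      ext u
      simp only [Finset.mem_union, Finset.mem_map, A, A', Finset.mem_preimage]
      constructor
      · rintro (⟨s, hs, rfl⟩ | ⟨t, ht, rfl⟩)
        exacts [hs, ht]
      · intro hu
        rcases hlr u (hB u hu) with ⟨s, rfl⟩ | ⟨t, rfl⟩
        · exact Or.inl ⟨s, hu, rfl⟩
        · exact Or.inr ⟨t, hu, rfl⟩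
    obtain ⟨h1, h2⟩ := hunion A A' hA
    rw [hBA] at h1 h2
    exact ⟨(_, _), (_, _), h1.symm, h2.symm, ⟨A, hA, rfl, rfl⟩, ⟨A', hA', rfl, rfl⟩⟩

section TaylorBounds

variable [Finite σ] [Finite τ] {I : Ideal (MvPolynomial σ k)} {I' : Ideal (MvPolynomial τ k)}

lemma satisfiesLowerBound_taylorResolution_tensorIdeal
    (hI : I.IsHomogeneous (homogeneousSubmodule σ k))
    (hI' : I'.IsHomogeneous (homogeneousSubmodule τ k))
    (h : SatisfiesLowerBound (taylorResolution I) I)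
    (h' : SatisfiesLowerBound (taylorResolution I') I') :
    SatisfiesLowerBound (taylorResolution (tensorIdeal I I')) (tensorIdeal I I') := by
  obtain ⟨c, -, -, hc, -⟩ := id h
  obtain ⟨c', -, -, hc', -⟩ := id h'
  rw [← satisfiesLowerBound_congr (betti_taylorResolution_tensorIdeal_ne_zero_iff
    (ne_top_of_hasCodim hc) (ne_top_of_hasCodim hc'))]
  exact h.tensor hI hI' (startsInDegreeZero_taylorResolution I)
    (startsInDegreeZero_taylorResolution I') h'

lemma satisfiesUpperBound_taylorResolution_tensorIdeal
    (hI : I.IsHomogeneous (homogeneousSubmodule σ k))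
    (hI' : I'.IsHomogeneous (homogeneousSubmodule τ k))
    (h : SatisfiesUpperBound (taylorResolution I) I)
    (h' : SatisfiesUpperBound (taylorResolution I') I') :
    SatisfiesUpperBound (taylorResolution (tensorIdeal I I')) (tensorIdeal I I') := by
  obtain ⟨c, -, -, hc, -⟩ := id h
  obtain ⟨c', -, -, hc', -⟩ := id h'
  rw [← satisfiesUpperBound_congr (betti_taylorResolution_tensorIdeal_ne_zero_iff
    (ne_top_of_hasCodim hc) (ne_top_of_hasCodim hc'))]
  exact h.tensor hI hI' (startsInDegreeZero_taylorResolution I)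
    (startsInDegreeZero_taylorResolution I') h'

lemma satisfiesConjecture_taylorResolution_tensorIdeal
    (hI : I.IsHomogeneous (homogeneousSubmodule σ k))
    (hI' : I'.IsHomogeneous (homogeneousSubmodule τ k))
    (h : SatisfiesConjecture (taylorResolution I) I)
    (h' : SatisfiesConjecture (taylorResolution I') I') :
    SatisfiesConjecture (taylorResolution (tensorIdeal I I')) (tensorIdeal I I') := by
  obtain ⟨c, -, -, hc, -⟩ := h.1
  obtain ⟨c', -, -, hc', -⟩ := h'.1
  have hb := betti_taylorResolution_tensorIdeal_ne_zero_iff (ne_top_of_hasCodim hc)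
    (ne_top_of_hasCodim hc')
  rw [SatisfiesConjecture, ← satisfiesUpperBound_congr hb, ← satisfiesLowerBound_congr hb]
  exact h.tensor hI hI' (startsInDegreeZero_taylorResolution I)
    (startsInDegreeZero_taylorResolution I') h'

end TaylorBounds

end MonomialIdeals

end MultiplicityConjecture

open MultiplicityConjecture in
theorem theorem3p1 {k : Type*} [Field k] {σ τ : Type*} [Finite σ] [Finite τ]
    (I : Ideal (MvPolynomial σ k)) (I' : Ideal (MvPolynomial τ k))
    (hI : I.IsHomogeneous (homogeneousSubmodule σ k))
    (hI' : I'.IsHomogeneous (homogeneousSubmodule τ k)) :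
    -- `(S/I) ⊗ (S'/I')` is the quotient of `S''` by the homogeneous ideal `tensorIdeal I I'`
    ((tensorIdeal I I').IsHomogeneous (homogeneousSubmodule (σ ⊕ τ) k) ∧
      ∃ Φ : ((MvPolynomial σ k ⧸ I) ⊗[k] (MvPolynomial τ k ⧸ I')) ≃ₐ[k]
          (MvPolynomial (σ ⊕ τ) k ⧸ tensorIdeal I I'),
        ∀ p q, Φ (Ideal.Quotient.mk I p ⊗ₜ[k] Ideal.Quotient.mk I' q) =
          Ideal.Quotient.mk (tensorIdeal I I') (rename Sum.inl p * rename Sum.inr q)) ∧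
    -- arbitrary graded free resolutions
    (∀ (F : GradedFreeComplex k σ) (F' : GradedFreeComplex k τ),
      F.IsResolution I → F'.IsResolution I' →
        (F.tensor F').IsResolution (tensorIdeal I I') ∧
        (SatisfiesLowerBound F I → SatisfiesLowerBound F' I' →
          SatisfiesLowerBound (F.tensor F') (tensorIdeal I I')) ∧
        (SatisfiesUpperBound F I → SatisfiesUpperBound F' I' →
          SatisfiesUpperBound (F.tensor F') (tensorIdeal I I')) ∧
        (SatisfiesConjecture F I → SatisfiesConjecture F' I' →
          SatisfiesConjecture (F.tensor F') (tensorIdeal I I'))) ∧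
    -- minimal free resolutions: the multiplicity conjecture
    ((MinimalResolutionSatisfies SatisfiesLowerBound I →
        MinimalResolutionSatisfies SatisfiesLowerBound I' →
        MinimalResolutionSatisfies SatisfiesLowerBound (tensorIdeal I I')) ∧
      (MinimalResolutionSatisfies SatisfiesUpperBound I →
        MinimalResolutionSatisfies SatisfiesUpperBound I' →
        MinimalResolutionSatisfies SatisfiesUpperBound (tensorIdeal I I')) ∧
      (MinimalResolutionSatisfies SatisfiesConjecture I →
        MinimalResolutionSatisfies SatisfiesConjecture I' →
        MinimalResolutionSatisfies SatisfiesConjecture (tensorIdeal I I'))) ∧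
    -- Taylor resolutions of monomial ideals: the Taylor conjecture
    (IsMonomialIdeal I → IsMonomialIdeal I' →
      IsMonomialIdeal (tensorIdeal I I') ∧
      (SatisfiesLowerBound (taylorResolution I) I →
        SatisfiesLowerBound (taylorResolution I') I' →
        SatisfiesLowerBound (taylorResolution (tensorIdeal I I')) (tensorIdeal I I')) ∧
      (SatisfiesUpperBound (taylorResolution I) I →
        SatisfiesUpperBound (taylorResolution I') I' →
        SatisfiesUpperBound (taylorResolution (tensorIdeal I I')) (tensorIdeal I I')) ∧
      (SatisfiesConjecture (taylorResolution I) I →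
        SatisfiesConjecture (taylorResolution I') I' →
        SatisfiesConjecture (taylorResolution (tensorIdeal I I')) (tensorIdeal I I'))) := by
  refine ⟨⟨tensorIdeal_isHomogeneous I I' hI hI', quotTensorEquiv I I',
    quotTensorEquiv_tmul I I'⟩, ?_, ⟨?_, ?_, ?_⟩, ?_⟩
  · intro F F' hF hF'
    have h0 := hF.startsInDegreeZero
    have h0' := hF'.startsInDegreeZero
    exact ⟨hF.tensor hF', fun h h' => h.tensor hI hI' h0 h0' h',
      fun h h' => h.tensor hI hI' h0 h0' h', fun h h' => h.tensor hI hI' h0 h0' h'⟩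
  · rintro ⟨F, hF, hm, h⟩ ⟨F', hF', hm', h'⟩
    exact ⟨F.tensor F', hF.tensor hF', hm.tensor hm',
      h.tensor hI hI' hF.startsInDegreeZero hF'.startsInDegreeZero h'⟩
  · rintro ⟨F, hF, hm, h⟩ ⟨F', hF', hm', h'⟩
    exact ⟨F.tensor F', hF.tensor hF', hm.tensor hm',
      h.tensor hI hI' hF.startsInDegreeZero hF'.startsInDegreeZero h'⟩
  · rintro ⟨F, hF, hm, h⟩ ⟨F', hF', hm', h'⟩
    exact ⟨F.tensor F', hF.tensor hF', hm.tensor hm',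
      h.tensor hI hI' hF.startsInDegreeZero hF'.startsInDegreeZero h'⟩
  · intro hmon hmon'
    exact ⟨hmon.tensorIdeal hmon', satisfiesLowerBound_taylorResolution_tensorIdeal hI hI',
      satisfiesUpperBound_taylorResolution_tensorIdeal hI hI',
      satisfiesConjecture_taylorResolution_tensorIdeal hI hI'⟩
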